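/- **Setting.** A bidder takes part in repeated second-price auctions. Within an episode, auctions arrive along a Poisson process of rate $\mu>0$; the episode length is an independent exponential time of rate $\gamma>0$. The prices-to-beat $b_i^-\in[0,+\infty]$ are i.i.d. (and independent of the rest) with $\mathbb P(b_i^-<b)=q(b)$; a missing mass $1-q(\infty)$ sits at $+\infty$. A policy is a measurable map $\pi:\mathbb R_+\to\mathbb R_+$: when the time elapsed since the last win is $a$, the bidder bids $\pi(a)$. Auction $i$ is won if the bid exceeds $b_i^-$; it then contributes the mean reward $k(a)$ minus the payment $b_i^-$, and the elapsed time is reset to $0$. Let $V^\pi_{k,q}(\tau)$ be the expected total payoff of an episode that starts with elapsed time $\tau$, let $V^\star_{k,q}(\tau)=\sup_\pi V^\pi_{k,q}(\tau)$ be the Bellman value, and let $$\mathcal S(k,q)(\tau)=\max\bigl(0,\;k(\tau)+V^\star_{k,q}(0)-V^\star_{k,q}(\tau)\bigr).$$ For breakpoints $0=t_0<\dots<t_m$, let $\mathcal K$ be the set of functions $k(\tau)=\sum_{i=1}^m a_i\,(t_i\wedge\tau-t_{i-1}\wedge\tau)$ with $a_1\ge\dots\ge a_m\ge0$. For breakpoints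 $0=b_0<\dots<b_n$, let $\mathcal Q$ be the set of functions $q(v)=\sum_{i=1}^n c_i\,(b_i\wedge v-b_{i-1}\wedge v)$ with all $c_i>0$ and $q\le1$. **Proposition ($\epsilon$-optimality).** For all $\mu,\gamma>0$, $k_{\max}\in\mathbb R$ and $c_{\max}\ge0$ there are constants $C>0$ and $\epsilon_0>0$ such that the following holds for all such breakpoints and all $k^\star\in\mathcal K$ and $q^\star\in\mathcal Q$ with $k^\star\le k_{\max}$ and with $q^\star$ being $c_{\max}$-Lipschitz. Put $\pi^\star=\mathcal S(k^\star,q^\star)$, $V^\star=V^\star_{k^\star,q^\star}$ and $V^\pi=V^\pi_{k^\star,q^\star}$. Then $\pi^\star$ is an optimal policy for $(k^\star,q^\star)$ (from every initial elapsed time), the limit $\beta(\pi^\star)=\lim_{\tau\to\infty}\pi^\star(\tau)$ exists, and for all $0<\epsilon\le\epsilon_0$, $k\in\mathcal K$ and $q\in\mathcal Q$ with $$\sup_{\tau\ge0}|k^\star(\tau)-k(\tau)|\le\epsilon\qquad\text{and}\qquad \max_{v\in[0,\beta(\pi^\star)]}|q^\star(v)-q(v)|\le\epsilon,$$ the policy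 $\pi=\mathcal S(k,q)$ satisfies $$\sup_{\tau\ge0}|\pi^\star(\tau)-\pi(\tau)|\le C\epsilon\qquad\text{and}\qquad \sup_{\tau\ge0}|V^\star(\tau)-V^{\pi}(\tau)|\le C\epsilon^2 .$$ -/

import Mathlib

open MeasureTheory ProbabilityTheory Filter Topology
open scoped NNReal unitInterval

noncomputable section

namespace DynamicBidding

/-- A finite grid of breakpoints `0 = s₀ < s₁ < ⋯ < sₙ`. -/
def IsGrid {n : ℕ} (s : Fin (n + 1) → ℝ) : Prop :=
  s 0 = 0 ∧ StrictMono s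

/-- The function `x ↦ ∑ᵢ cᵢ (sᵢ ∧ x - sᵢ₋₁ ∧ x)` with slope `cᵢ` on `[sᵢ₋₁, sᵢ]`.
It vanishes for `x ≤ s₀` and is constant for `x ≥ sₙ`. -/
def piecewiseLinear {n : ℕ} (s : Fin (n + 1) → ℝ) (c : Fin n → ℝ) (x : ℝ) : ℝ :=
  ∑ i : Fin n, c i * (min (s i.succ) x - min (s i.castSucc) x)

/-- The class of value functions `k`: piecewise linear, concave and nondecreasing, with breakpoints
in `t`, with `k 0 = 0`, and with slope `0` after the last breakpoint. -/
def ValueClass {m : ℕ} (t : Fin (m + 1) → ℝ) : Set (ℝ → ℝ) :=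
  {k | ∃ a : Fin m → ℝ, Antitone a ∧ (∀ i, 0 ≤ a i) ∧ k = piecewiseLinear t a}

/-- The class of win probabilities `q`: piecewise linear with positive slopes between the
breakpoints `b`, and bounded by `1`. The missing mass `1 - q(bₙ)` is the probability that the
price-to-beat is out of reach of every bid. -/
def WinClass {n : ℕ} (b : Fin (n + 1) → ℝ) : Set (ℝ → ℝ) :=
  {q | ∃ c : Fin n → ℝ, (∀ i, 0 < c i) ∧ q = piecewiseLinear b c ∧ ∀ v, q v ≤ 1}

/-- The price-to-beat with (possibly defective) distribution function `q`, drawn by inverse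
transform sampling from a uniform seed `u`; it is `+∞` if `u` exceeds every value of `q`. -/
def priceToBeat (q : ℝ → ℝ) (u : I) : EReal :=
  sInf {x : EReal | ∃ v : ℝ, (u : ℝ) ≤ q v ∧ x = (v : EReal)}

/-- The price-to-beat falls below the bid `b` with probability `q b`. -/
theorem volume_priceToBeat_lt {q : ℝ → ℝ} (hmono : Monotone q) (hcont : Continuous q)
    (h0 : ∀ v, 0 ≤ q v) (h1 : ∀ v, q v ≤ 1) (b : ℝ) :
    volume {u : I | priceToBeat q u < (b : EReal)} = ENNReal.ofReal (q b) := by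
  have hle : {u : I | priceToBeat q u < (b : EReal)} ⊆ Set.Iic ⟨q b, h0 b, h1 b⟩ := by
    intro u hu
    have hu' : priceToBeat q u < (b : EReal) := hu
    obtain ⟨x, ⟨v, hv, rfl⟩, hx⟩ := sInf_lt_iff.1 hu'
    exact Subtype.coe_le_coe.1 (hv.trans (hmono (EReal.coe_lt_coe_iff.1 hx).le))
  have hge : Set.Iio ⟨q b, h0 b, h1 b⟩ ⊆ {u : I | priceToBeat q u < (b : EReal)} := by
    intro u hu
    have hu' : (u : ℝ) < q b := hu
    have hev : ∀ᶠ v in 𝓝[<] b, (u : ℝ) < q v :=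
      (hcont.continuousAt.eventually (lt_mem_nhds hu')).filter_mono nhdsWithin_le_nhds
    obtain ⟨v, hv, hvb⟩ := (hev.and self_mem_nhdsWithin).exists
    have hlt : priceToBeat q u < (b : EReal) :=
      sInf_lt_iff.2 ⟨(v : EReal), ⟨v, hv.le, rfl⟩, EReal.coe_lt_coe_iff.2 hvb⟩
    exact hlt
  refine le_antisymm ((measure_mono hle).trans_eq ?_) (le_trans (le_of_eq ?_) (measure_mono hge))
  · simp
  · simp

/-- The randomness of an episode: for each auction, the waiting time since the previous auction
and the uniform seed of the price-to-beat; and the length of the episode. -/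
abbrev Episode : Type := (ℕ → ℝ × I) × ℝ

/-- Auctions arrive along a Poisson process of rate `μ` (i.i.d. exponential waiting times),
prices-to-beat are i.i.d., the episode length is exponential of rate `γ`, all independent. -/
def episodeLaw (μ γ : ℝ) : Measure Episode :=
  (Measure.infinitePi fun _ : ℕ => (expMeasure μ).prod (volume : Measure I)).prod (expMeasure γ)

/-- The arrival time of auction `n` (auctions are numbered from `0`). -/
def arrival (ω : Episode) (n : ℕ) : ℝ :=
  ∑ j ∈ Finset.range (n + 1), (ω.1 j).1

/-- The time elapsed since the last win when auction `n` arrives, if the bidder bids `π a` at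
elapsed time `a` and the episode starts at elapsed time `τ`; auction `n` is won if the bid exceeds
the price-to-beat. -/
def age (q : ℝ → ℝ) (π : ℝ≥0 → ℝ≥0) (τ : ℝ≥0) (ω : Episode) : ℕ → ℝ≥0
  | 0 => τ + (ω.1 0).1.toNNReal
  | n + 1 =>
    open Classical in
    (if priceToBeat q (ω.1 n).2 < ((π (age q π τ ω n) : ℝ) : EReal) then 0 else age q π τ ω n)
      + (ω.1 (n + 1)).1.toNNReal

/-- Auction `n` takes place before the end of the episode and is won. -/
def Wins (q : ℝ → ℝ) (π : ℝ≥0 → ℝ≥0) (τ : ℝ≥0) (ω : Episode) (n : ℕ) : Prop :=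
  arrival ω n ≤ ω.2 ∧ priceToBeat q (ω.1 n).2 < ((π (age q π τ ω n) : ℝ) : EReal)

/-- The total (mean) reward minus second-price payment over the auctions won in an episode. -/
def payoff (k q : ℝ → ℝ) (π : ℝ≥0 → ℝ≥0) (τ : ℝ≥0) (ω : Episode) : ℝ :=
  open Classical in
  ∑' n : ℕ, if Wins q π τ ω n then
    k (age q π τ ω n) - (priceToBeat q (ω.1 n).2).toReal else 0

/-- The expected payoff of the policy `π` in the environment `(k, q)` from elapsed time `τ`. -/
def policyValue (μ γ : ℝ) (k q : ℝ → ℝ) (π : ℝ≥0 → ℝ≥0) (τ : ℝ≥0) : ℝ :=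
  ∫ ω, payoff k q π τ ω ∂(episodeLaw μ γ)

/-- The Bellman value: the largest expected payoff over all (measurable) policies. -/
def bellmanValue (μ γ : ℝ) (k q : ℝ → ℝ) (τ : ℝ≥0) : ℝ :=
  ⨆ π : {π : ℝ≥0 → ℝ≥0 // Measurable π}, policyValue μ γ k q π.1 τ

/-- `π` is a policy whose expected payoff is maximal from every initial elapsed time. -/
def IsOptimal (μ γ : ℝ) (k q : ℝ → ℝ) (π : ℝ≥0 → ℝ≥0) : Prop :=
  Measurable π ∧ ∀ π' : ℝ≥0 → ℝ≥0, Measurable π' →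
    ∀ τ, policyValue μ γ k q π' τ ≤ policyValue μ γ k q π τ

/-- The policy synthesized from the Bellman value,
`𝒮(k, q)(τ) = max (0, k(τ) + V⋆(0) - V⋆(τ))`. -/
def solver (μ γ : ℝ) (k q : ℝ → ℝ) (τ : ℝ≥0) : ℝ≥0 :=
  (k τ + bellmanValue μ γ k q 0 - bellmanValue μ γ k q τ).toNNReal

end DynamicBidding

end

noncomputable section

namespace DynamicBidding

/-! An independent exponential episode length amounts to discounting: given the waiting times,
auction `n` takes place with probability `discProd γ n`. The value of a policy is therefore a
geometrically convergent series of discounted auction payoffs (`hasSum_auctionValue`). Conditioning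
on the first auction gives the renewal equation `policyValue_eq_stepMean`. In it, a win at age `a`
exchanges `V a` for `k a + V 0` minus the price, so each auction is a one-shot second-price auction
for an object worth `p = k a + V 0 - V a`, and bidding `p` is optimal.

Write `G p` for the mean surplus of the truthful bid `p`. It equals `∫ q` over `[0, p]`, so its
slope `q` lies in `[0, 1]`. Hence `v + G (w - v)` moves by at most `E` when both `v` and `w` move by
at most `E` (`add_le_add_of_slope`), although `V` enters both at `a` and at `0`. The Bellman
operator thus contracts by the mean discount factor `rho < 1`. Its fixed point is the Bellman value,
and nearly every later estimate has the form "if `D ≤ M` then `D ≤ rho * M + δ`"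
(`le_of_contractive`).

Two facts give the rates. First, an error `ε` in `k` and in `q` on `[0, β]` moves the fixed point by
`O(ε)`, because the two surplus functions need to be compared only at bids of the true environment;
bids therefore move by `O(ε)`. Second, bidding `b` instead of `p` costs at most `(p - b) * (q p - q
b)` in one auction, which is quadratic in the deviation for Lipschitz `q`; discounted summation
turns this into `O(ε ^ 2)`. The limit bid exists because concavity of `k` makes the bid
nondecreasing in the age. -/

/-! ### Waiting times and discounting -/

/-- The discount factor accumulated over a waiting time `s`. -/
def disc (γ s : ℝ) : ℝ := Real.exp (-(γ * max s 0))

theorem disc_pos (γ s : ℝ) : 0 < disc γ s := Real.exp_pos _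

theorem disc_le_one {γ : ℝ} (hγ : 0 < γ) (s : ℝ) : disc γ s ≤ 1 :=
  Real.exp_le_one_iff.2 (by have := mul_nonneg hγ.le (le_max_right s 0); linarith)

theorem disc_lt_one {γ s : ℝ} (hγ : 0 < γ) (hs : 0 < s) : disc γ s < 1 :=
  Real.exp_lt_one_iff.2 (by rw [max_eq_left hs.le]; have := mul_pos hγ hs; linarith)

theorem abs_disc_le_one {γ : ℝ} (hγ : 0 < γ) (s : ℝ) : |disc γ s| ≤ 1 := by
  rw [abs_of_pos (disc_pos γ s)]; exact disc_le_one hγ s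

@[fun_prop]
theorem continuous_disc (γ : ℝ) : Continuous (disc γ) := by unfold disc; fun_prop

@[fun_prop]
theorem measurable_disc (γ : ℝ) : Measurable (disc γ) := (continuous_disc γ).measurable

theorem measure_Iic_expMeasure {r : ℝ} (hr : 0 < r) (x : ℝ) :
    (expMeasure r).real (Set.Iic x) = if 0 ≤ x then 1 - Real.exp (-(r * x)) else 0 := by
  have := isProbabilityMeasure_expMeasure hr
  rw [← cdf_eq_real, cdf_expMeasure_eq hr]

/-- Having no atoms lets the survival probability be read off the distribution function for closed
rays as well, as the condition `arrival ω n ≤ ω.2` requires. -/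
theorem expMeasure_singleton (r x : ℝ) : expMeasure r {x} = 0 := by
  have h : expMeasure r ≪ volume := withDensity_absolutelyContinuous _ _
  exact h (by simp)

theorem ae_pos_expMeasure {r : ℝ} (hr : 0 < r) : ∀ᵐ s ∂(expMeasure r), 0 < s := by
  have := isProbabilityMeasure_expMeasure hr
  have h := measure_Iic_expMeasure hr 0
  simp only [le_refl, if_true, mul_zero, neg_zero, Real.exp_zero, sub_self] at h
  rw [ae_iff]
  have h2 : {a : ℝ | ¬ 0 < a} = Set.Iic 0 := by ext; simp
  rw [h2]
  exact (measureReal_eq_zero_iff).1 h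

theorem measure_Ici_expMeasure {r : ℝ} (hr : 0 < r) {x : ℝ} (hx : 0 ≤ x) :
    (expMeasure r).real (Set.Ici x) = Real.exp (-(r * x)) := by
  have := isProbabilityMeasure_expMeasure hr
  have h := measure_Iic_expMeasure hr x
  rw [if_pos hx] at h
  have h1 : (expMeasure r).real (Set.Iic x)ᶜ = 1 - (expMeasure r).real (Set.Iic x) :=
    probReal_compl_eq_one_sub measurableSet_Iic
  rw [Set.compl_Iic] at h1
  have h2 : (expMeasure r).real (Set.Ici x) = (expMeasure r).real (Set.Ioi x) := by
    apply measureReal_congr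
    rw [← Set.Ioi_insert]
    have : NullSingletonClass (expMeasure r) := ⟨expMeasure_singleton r⟩
    exact insert_ae_eq_self x _
  rw [h2, h1, h]; ring

/-- The mean discount factor between two consecutive auctions. -/
def rho (μ γ : ℝ) : ℝ := ∫ s, disc γ s ∂(expMeasure μ)

theorem integrable_disc {μ γ : ℝ} (hμ : 0 < μ) (hγ : 0 < γ) :
    Integrable (disc γ) (expMeasure μ) := by
  have := isProbabilityMeasure_expMeasure hμ
  exact Integrable.of_bound (by fun_prop) 1 (ae_of_all _ fun s => abs_disc_le_one hγ s)

theorem rho_nonneg (μ γ : ℝ) : 0 ≤ rho μ γ :=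
  integral_nonneg fun s => (disc_pos γ s).le

/-- Waiting times are almost surely positive, so `1 - disc γ s` is positive almost everywhere. This
strict inequality is the contraction constant of the whole analysis. -/
theorem rho_lt_one {μ γ : ℝ} (hμ : 0 < μ) (hγ : 0 < γ) : rho μ γ < 1 := by
  have := isProbabilityMeasure_expMeasure hμ
  have h1 : 0 < ∫ s, (1 - disc γ s) ∂(expMeasure μ) := by
    rw [integral_pos_iff_support_of_nonneg (fun s => sub_nonneg.2 (disc_le_one hγ s))
      ((integrable_const 1).sub (integrable_disc hμ hγ))]
    have h : expMeasure μ (Function.support fun s => 1 - disc γ s) = 1 := by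
      rw [← prob_compl_eq_zero_iff₀]
      · have h2 := ae_pos_expMeasure hμ
        have h3 : ∀ᵐ s ∂(expMeasure μ), s ∈ Function.support fun s => 1 - disc γ s :=
          h2.mono fun s hs => (sub_pos.2 (disc_lt_one hγ hs)).ne'
        exact h3
      · exact (measurableSet_support (by fun_prop)).nullMeasurableSet
    rw [h]; exact one_pos
  rw [integral_sub (integrable_const 1) (integrable_disc hμ hγ)] at h1
  simp only [integral_const, probReal_univ, one_smul] at h1
  unfold rho; linarith

/-! ### Sequences of auctions -/

/-- The sequence with first element `p.1` and the later elements given by `p.2`. -/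
def consSeq {X : Type*} (p : X × (ℕ → X)) : ℕ → X
  | 0 => p.1
  | n + 1 => p.2 n

theorem measurable_consSeq {X : Type*} [MeasurableSpace X] :
    Measurable (consSeq : X × (ℕ → X) → ℕ → X) := by
  rw [measurable_pi_iff]
  intro n
  cases n with
  | zero => exact measurable_fst
  | succ n => exact (measurable_pi_apply n).comp measurable_snd

/-- Prepending an independent sample to an i.i.d. sequence gives an i.i.d. sequence with the same
law. The product measure is determined by finite boxes, and the preimage of a box is again a box. -/
theorem measurePreserving_consSeq {X : Type*} [MeasurableSpace X] (ν : Measure X)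
    [IsProbabilityMeasure ν] :
    MeasurePreserving consSeq (ν.prod (Measure.infinitePi fun _ : ℕ => ν))
      (Measure.infinitePi fun _ : ℕ => ν) := by
  refine ⟨measurable_consSeq, Measure.eq_infinitePi _ fun s t ht => ?_⟩
  rw [Measure.map_apply measurable_consSeq (MeasurableSet.pi s.countable_toSet fun i _ => ht i)]
  classical
  -- The finite index set `s` need not contain `0`; the first sample is then unconstrained.
  set A : Set X := if 0 ∈ s then t 0 else Set.univ
  set s' : Finset ℕ := s.preimage Nat.succ (Nat.succ_injective.injOn)
  have hpre : consSeq ⁻¹' (Set.pi (s : Set ℕ) t)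
      = A ×ˢ Set.pi (s' : Set ℕ) (fun i => t (i + 1)) := by
    ext ⟨x, y⟩
    simp only [Set.mem_preimage, Set.mem_pi, Finset.mem_coe, Set.mem_prod]
    constructor
    · intro h
      refine ⟨?_, fun i hi => h (i + 1) (by simpa [s'] using hi)⟩
      by_cases h0 : 0 ∈ s
      · have h2 := h 0 h0
        simpa [A, h0] using (show x ∈ t 0 from h2)
      · simp [A, h0]
    · rintro ⟨h0, h1⟩ i hi
      cases i with
      | zero => exact show x ∈ t 0 by simpa [A, hi] using h0
      | succ i => exact h1 i (by simpa [s'] using hi)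
  rw [hpre, Measure.prod_prod, Measure.infinitePi_pi _ fun i _ => ht (i + 1)]
  have hA : ν A = if 0 ∈ s then ν (t 0) else 1 := by
    by_cases h0 : 0 ∈ s <;> simp [A, h0]
  have hs' : ∏ i ∈ s', ν (t (i + 1)) = ∏ i ∈ s.erase 0, ν (t i) := by
    refine Finset.prod_bij (fun i _ => i + 1) ?_ ?_ ?_ ?_
    · intro i hi; simpa [s'] using hi
    · intro i _ j _ h; simpa using h
    · intro i hi
      obtain ⟨hi0, his⟩ := Finset.mem_erase.1 hi
      obtain ⟨j, rfl⟩ := Nat.exists_eq_succ_of_ne_zero hi0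
      exact ⟨j, by simpa [s'] using his, rfl⟩
    · intro i _; rfl
  rw [hA, hs']
  by_cases h0 : 0 ∈ s
  · rw [if_pos h0, Finset.mul_prod_erase s (fun i => ν (t i)) h0]
  · rw [if_neg h0, one_mul, Finset.erase_eq_of_notMem h0]

/-- Conditioning on the first auction, the source of all recursions in the number of auctions. -/
theorem integral_infinitePi_eq_consSeq {X : Type*} [MeasurableSpace X] (ν : Measure X)
    [IsProbabilityMeasure ν] {F : (ℕ → X) → ℝ} (hF : Measurable F) {M : ℝ}
    (hM : ∀ x, |F x| ≤ M) :
    ∫ x, F x ∂(Measure.infinitePi fun _ : ℕ => ν)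
      = ∫ z, ∫ x, F (consSeq (z, x)) ∂(Measure.infinitePi fun _ : ℕ => ν) ∂ν := by
  have h := measurePreserving_consSeq ν
  rw [← h.map_eq, integral_map measurable_consSeq.aemeasurable hF.aestronglyMeasurable,
    integral_prod, h.map_eq]
  exact Integrable.of_bound (hF.comp measurable_consSeq).aestronglyMeasurable M
    (ae_of_all _ fun p => hM _)

/-- The law of one auction: the waiting time and the seed of the price-to-beat. -/
def stepLaw (μ : ℝ) : Measure (ℝ × I) := (expMeasure μ).prod volume

theorem isProbabilityMeasure_stepLaw {μ : ℝ} (hμ : 0 < μ) :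
    IsProbabilityMeasure (stepLaw μ) := by
  have := isProbabilityMeasure_expMeasure hμ
  unfold stepLaw; infer_instance

theorem integral_disc_stepLaw {μ γ : ℝ} (hμ : 0 < μ) :
    ∫ z, disc γ z.1 ∂(stepLaw μ) = rho μ γ := by
  have := isProbabilityMeasure_expMeasure hμ
  have h := integral_fun_fst (μ := expMeasure μ) (ν := (volume : Measure I)) (disc γ)
  simpa [stepLaw, rho] using h

/-- The joint law of all auctions. -/
def seqLaw (μ : ℝ) : Measure (ℕ → ℝ × I) := Measure.infinitePi fun _ : ℕ => stepLaw μ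

theorem isProbabilityMeasure_seqLaw {μ : ℝ} (hμ : 0 < μ) :
    IsProbabilityMeasure (seqLaw μ) := by
  have := isProbabilityMeasure_stepLaw hμ
  unfold seqLaw; infer_instance

theorem episodeLaw_eq (μ γ : ℝ) : episodeLaw μ γ = (seqLaw μ).prod (expMeasure γ) := rfl

theorem ae_seqLaw_nonneg {μ : ℝ} (hμ : 0 < μ) : ∀ᵐ x ∂(seqLaw μ), ∀ n, 0 ≤ (x n).1 := by
  have := isProbabilityMeasure_stepLaw hμ
  have := isProbabilityMeasure_expMeasure hμ
  rw [ae_all_iff]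
  intro n
  have h1 : ∀ᵐ z ∂(stepLaw μ), 0 ≤ z.1 := by
    have h := Measure.quasiMeasurePreserving_fst (μ := expMeasure μ) (ν := (volume : Measure I))
    exact h.ae ((ae_pos_expMeasure hμ).mono fun s hs => hs.le)
  exact (measurePreserving_eval_infinitePi (fun _ : ℕ => stepLaw μ) n).quasiMeasurePreserving.ae h1

/-- The discount factor accumulated until auction `n`. -/
def discProd (γ : ℝ) (n : ℕ) (x : ℕ → ℝ × I) : ℝ :=
  ∏ j ∈ Finset.range (n + 1), disc γ (x j).1

@[fun_prop]
theorem measurable_discProd (γ : ℝ) (n : ℕ) : Measurable (discProd γ n) := by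
  unfold discProd; fun_prop

theorem discProd_nonneg (γ : ℝ) (n : ℕ) (x : ℕ → ℝ × I) : 0 ≤ discProd γ n x :=
  Finset.prod_nonneg fun _ _ => (disc_pos _ _).le

theorem discProd_le_one {γ : ℝ} (hγ : 0 < γ) (n : ℕ) (x : ℕ → ℝ × I) : discProd γ n x ≤ 1 :=
  Finset.prod_le_one (fun _ _ => (disc_pos _ _).le) fun _ _ => disc_le_one hγ _

theorem abs_discProd_le_one {γ : ℝ} (hγ : 0 < γ) (n : ℕ) (x : ℕ → ℝ × I) :
    |discProd γ n x| ≤ 1 := by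
  rw [abs_of_nonneg (discProd_nonneg γ n x)]; exact discProd_le_one hγ n x

theorem discProd_succ_consSeq (γ : ℝ) (n : ℕ) (z : ℝ × I) (x : ℕ → ℝ × I) :
    discProd γ (n + 1) (consSeq (z, x)) = disc γ z.1 * discProd γ n x := by
  unfold discProd
  rw [Finset.prod_range_succ' _ (n + 1), mul_comm]
  rfl

theorem discProd_zero_consSeq (γ : ℝ) (z : ℝ × I) (x : ℕ → ℝ × I) :
    discProd γ 0 (consSeq (z, x)) = disc γ z.1 := by
  simp [discProd, consSeq]

/-- Auctions are numbered from `0` and each is preceded by a waiting time, hence `n + 1` factors.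
This geometric decay makes the series of payoffs summable. -/
theorem integral_discProd {μ γ : ℝ} (hμ : 0 < μ) (hγ : 0 < γ) (n : ℕ) :
    ∫ x, discProd γ n x ∂(seqLaw μ) = rho μ γ ^ (n + 1) := by
  have := isProbabilityMeasure_stepLaw hμ
  have := isProbabilityMeasure_seqLaw hμ
  induction n with
  | zero =>
    rw [seqLaw, integral_infinitePi_eq_consSeq _ (measurable_discProd γ 0)
      (abs_discProd_le_one hγ 0)]
    simp [discProd_zero_consSeq, integral_disc_stepLaw hμ]
  | succ n ih =>
    rw [seqLaw, integral_infinitePi_eq_consSeq _ (measurable_discProd γ (n + 1))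
      (abs_discProd_le_one hγ (n + 1))]
    simp only [discProd_succ_consSeq, integral_const_mul]
    rw [← seqLaw, integral_mul_const, ih, integral_disc_stepLaw hμ]
    ring

/-- The exponential survival function is multiplicative over the waiting times. Almost surely these
are nonnegative, so the truncation inside `disc` has no effect. -/
theorem measure_arrival_le {μ γ : ℝ} (hμ : 0 < μ) (hγ : 0 < γ) (n : ℕ) :
    ∀ᵐ x ∂(seqLaw μ), (expMeasure γ).real {l | arrival (x, l) n ≤ l} = discProd γ n x := by
  filter_upwards [ae_seqLaw_nonneg hμ] with x hx
  have h : {l : ℝ | arrival (x, l) n ≤ l}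
      = Set.Ici (∑ j ∈ Finset.range (n + 1), (x j).1) := rfl
  rw [h, measure_Ici_expMeasure hγ (Finset.sum_nonneg fun j _ => hx j), discProd]
  simp only [disc, ← Real.exp_sum, Finset.sum_neg_distrib, Finset.mul_sum]
  congr 2
  exact Finset.sum_congr rfl fun j _ => by rw [max_eq_left (hx j)]

/-! ### The surplus of a single auction -/

/-- The properties of win probabilities that the analysis uses. -/
structure IsWin (q : ℝ → ℝ) : Prop where
  mono : Monotone q
  cont : Continuous q
  nonpos : ∀ v ≤ 0, q v = 0
  le_one : ∀ v, q v ≤ 1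
  const : ∃ B, 0 ≤ B ∧ ∀ v, B ≤ v → q v = q B

namespace IsWin

variable {q : ℝ → ℝ}

theorem nonneg (hq : IsWin q) (v : ℝ) : 0 ≤ q v := by
  rw [← hq.nonpos (min v 0) (min_le_right _ _)]
  exact hq.mono (min_le_left _ _)

/-- An upper bound for the finite prices. -/
def bound (hq : IsWin q) : ℝ := hq.const.choose

theorem bound_nonneg (hq : IsWin q) : 0 ≤ hq.bound := hq.const.choose_spec.1

/-- Finite prices lie in a bounded interval because `q` vanishes on the negatives and is eventually
constant. The seed `0`, a null event, is excluded since its price is `⊥`. -/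
theorem price_cases (hq : IsWin q) {u : I} (hu : 0 < (u : ℝ)) :
    priceToBeat q u = ⊤ ∨
      ∃ x : ℝ, 0 ≤ x ∧ x ≤ hq.bound ∧ priceToBeat q u = (x : EReal) := by
  rcases Set.eq_empty_or_nonempty {x : EReal | ∃ v : ℝ, (u : ℝ) ≤ q v ∧ x = (v : EReal)} with h | h
  · left; rw [priceToBeat, h, sInf_empty]
  · right
    obtain ⟨-, v, hv, rfl⟩ := h
    have h0 : (0 : EReal) ≤ priceToBeat q u := by
      refine le_sInf ?_
      rintro x ⟨w, hw, rfl⟩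
      rw [← EReal.coe_zero, EReal.coe_le_coe_iff]
      by_contra hneg
      rw [hq.nonpos w (not_le.1 hneg).le] at hw
      exact absurd hu (not_lt.2 hw)
    have h1 : priceToBeat q u ≤ (hq.bound : EReal) := by
      refine sInf_le ⟨hq.bound, hv.trans ?_, rfl⟩
      rw [bound, ← hq.const.choose_spec.2 (max v hq.bound) (le_max_right _ _)]
      exact hq.mono (le_max_left _ _)
    have hne : priceToBeat q u ≠ ⊤ := (h1.trans_lt (EReal.coe_lt_top _)).ne
    have hne' : priceToBeat q u ≠ ⊥ := fun h => by simp [h] at h0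
    rw [← EReal.coe_toReal hne hne'] at h0 h1 ⊢
    exact ⟨_, EReal.coe_nonneg.1 h0, EReal.coe_le_coe_iff.1 h1, rfl⟩

end IsWin

theorem measurable_priceToBeat (q : ℝ → ℝ) : Measurable (priceToBeat q) := by
  refine Monotone.measurable fun u u' h => ?_
  exact sInf_le_sInf fun x ⟨v, hv, hx⟩ => ⟨v, le_trans (Subtype.coe_le_coe.2 h) hv, hx⟩

theorem ae_pos_unitInterval : ∀ᵐ u : I, 0 < (u : ℝ) := by
  have h : ∀ᵐ u : I, u ≠ 0 := by
    rw [ae_iff]; simp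
  exact h.mono fun u hu => unitInterval.pos_iff_ne_zero.2 hu

/-- The surplus of a bid `b` in an auction whose object is worth `p`. -/
def surplus (q : ℝ → ℝ) (p b : ℝ) (u : I) : ℝ :=
  open Classical in
  if priceToBeat q u < (b : EReal) then p - (priceToBeat q u).toReal else 0

@[fun_prop]
theorem measurable_surplus {X : Type*} [MeasurableSpace X] (q : ℝ → ℝ) {p b : X → ℝ} {u : X → I}
    (hp : Measurable p) (hb : Measurable b) (hu : Measurable u) :
    Measurable fun x => surplus q (p x) (b x) (u x) := by
  unfold surplus
  have h := (measurable_priceToBeat q).comp hu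
  refine Measurable.ite (measurableSet_lt h hb.coe_real_ereal) ?_ measurable_const
  exact hp.sub h.ereal_toReal

section

variable {q : ℝ → ℝ}

theorem surplus_cases (hq : IsWin q) {u : I} (hu : 0 < (u : ℝ)) :
    (∀ p b, surplus q p b u = 0) ∨ ∃ x : ℝ, 0 ≤ x ∧ x ≤ hq.bound ∧
      ∀ p b, surplus q p b u = if x < b then p - x else 0 := by
  rcases hq.price_cases hu with h | ⟨x, h0, h1, h⟩
  · left; intro p b; simp [surplus, h]
  · right
    refine ⟨x, h0, h1, fun p b => ?_⟩
    simp [surplus, h]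

theorem abs_surplus_le (hq : IsWin q) (u : I) (p b : ℝ) :
    |surplus q p b u| ≤ |p| + hq.bound := by
  have hB := hq.bound_nonneg
  rcases (unitInterval.nonneg u).eq_or_lt with hu | hu
  · have h : priceToBeat q u = ⊥ := by
      refine (EReal.eq_bot_iff_forall_lt _).2 fun y => ?_
      refine lt_of_le_of_lt (sInf_le ⟨y - 1, ?_, rfl⟩) (EReal.coe_lt_coe_iff.2 (sub_one_lt y))
      rw [← hu]; exact hq.nonneg _
    simp only [surplus, h]
    split_ifs <;> simp <;> positivity
  rcases surplus_cases hq hu with h | ⟨x, h0, h1, h⟩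
  · rw [h, abs_zero]; positivity
  · rw [h]
    split_ifs
    · calc |p - x| ≤ |p| + |x| := abs_sub _ _
        _ ≤ _ := by rw [abs_of_nonneg h0]; linarith
    · rw [abs_zero]; positivity

theorem integrable_surplus (hq : IsWin q) (p b : ℝ) : Integrable (surplus q p b) := by
  refine Integrable.of_bound (C := |p| + hq.bound) (Measurable.aestronglyMeasurable (by fun_prop)) ?_
  exact ae_of_all _ fun u => abs_surplus_le hq u p b

/-- Truthfulness of the second-price auction: the bid decides only whether `p - x` is collected, and
the bid `p` collects it exactly when it is positive. -/
theorem surplus_le_surplus_self (hq : IsWin q) {u : I} (hu : 0 < (u : ℝ)) (p b : ℝ) :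
    surplus q p b u ≤ surplus q p p u := by
  rcases surplus_cases hq hu with h | ⟨x, h0, h1, h⟩
  · simp [h]
  · rw [h, h]; split_ifs <;> linarith

theorem surplus_max_zero (hq : IsWin q) {u : I} (hu : 0 < (u : ℝ)) (p : ℝ) :
    surplus q p (max p 0) u = surplus q p p u := by
  rcases surplus_cases hq hu with h | ⟨x, h0, h1, h⟩
  · simp [h]
  · rw [h, h]
    have : x < max p 0 ↔ x < p := by
      rw [lt_max_iff]; exact ⟨fun h => h.resolve_right (not_lt.2 h0), Or.inl⟩
    simp [this]

/-- The truthful surplus is the positive part of `p - x`, whose slope in `p` lies in `[0, 1]`. -/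
theorem surplus_self_mono (hq : IsWin q) {u : I} (hu : 0 < (u : ℝ)) {p p' : ℝ} (h : p ≤ p') :
    surplus q p p u ≤ surplus q p' p' u ∧ surplus q p' p' u ≤ surplus q p p u + (p' - p) := by
  rcases surplus_cases hq hu with h' | ⟨x, h0, h1, h'⟩
  · simp [h', h]
  · rw [h', h']; constructor <;> split_ifs <;> linarith

/-- The expected surplus of a bid `b` in an auction whose object is worth `p`. -/
def meanSurplus (q : ℝ → ℝ) (p b : ℝ) : ℝ := ∫ u, surplus q p b u

theorem abs_meanSurplus_le (hq : IsWin q) (p b : ℝ) : |meanSurplus q p b| ≤ |p| + hq.bound := by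
  have h := norm_integral_le_of_norm_le_const (μ := (volume : Measure I))
    (f := surplus q p b) (ae_of_all _ fun u => abs_surplus_le hq u p b)
  simpa [meanSurplus] using h

theorem meanSurplus_le_self (hq : IsWin q) (p b : ℝ) : meanSurplus q p b ≤ meanSurplus q p p :=
  integral_mono_ae (integrable_surplus hq p b) (integrable_surplus hq p p)
    (ae_pos_unitInterval.mono fun _ hu => surplus_le_surplus_self hq hu p b)

theorem meanSurplus_max_zero (hq : IsWin q) (p : ℝ) :
    meanSurplus q p (max p 0) = meanSurplus q p p :=
  integral_congr_ae (ae_pos_unitInterval.mono fun _ hu => surplus_max_zero hq hu p)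

theorem meanSurplus_self_mono (hq : IsWin q) {p p' : ℝ} (h : p ≤ p') :
    meanSurplus q p p ≤ meanSurplus q p' p' :=
  integral_mono_ae (integrable_surplus hq p p) (integrable_surplus hq p' p')
    (ae_pos_unitInterval.mono fun _ hu => (surplus_self_mono hq hu h).1)

theorem meanSurplus_self_le_add (hq : IsWin q) {p p' : ℝ} (h : p ≤ p') :
    meanSurplus q p' p' ≤ meanSurplus q p p + (p' - p) := by
  have h1 : meanSurplus q p p + (p' - p) = ∫ u : I, (surplus q p p u + (p' - p)) := by
    rw [integral_add (integrable_surplus hq p p) (integrable_const _)]; simp [meanSurplus]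
  rw [h1]
  exact integral_mono_ae (integrable_surplus hq p' p')
    ((integrable_surplus hq p p).add (integrable_const _))
    (ae_pos_unitInterval.mono fun _ hu => (surplus_self_mono hq hu h).2)

theorem abs_meanSurplus_self_sub_le (hq : IsWin q) (p p' : ℝ) :
    |meanSurplus q p p - meanSurplus q p' p'| ≤ |p - p'| := by
  rcases le_total p p' with h | h
  · have h1 := meanSurplus_self_mono hq h
    have h2 := meanSurplus_self_le_add hq h
    rw [abs_sub_comm, abs_sub_comm p, abs_of_nonneg (by linarith), abs_of_nonneg (by linarith)]
    linarith
  · have h1 := meanSurplus_self_mono hq h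
    have h2 := meanSurplus_self_le_add hq h
    rw [abs_of_nonneg (by linarith), abs_of_nonneg (by linarith)]
    linarith

theorem meanSurplus_mono_left (hq : IsWin q) (b : ℝ) {p p' : ℝ} (h : p ≤ p') :
    meanSurplus q p b ≤ meanSurplus q p' b := by
  refine integral_mono (integrable_surplus hq p b) (integrable_surplus hq p' b) fun u => ?_
  simp only [surplus]; split_ifs <;> linarith

theorem meanSurplus_le_add_left (hq : IsWin q) (b : ℝ) {p p' : ℝ} (h : p ≤ p') :
    meanSurplus q p' b ≤ meanSurplus q p b + (p' - p) := by
  have h1 : meanSurplus q p b + (p' - p) = ∫ u : I, (surplus q p b u + (p' - p)) := by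
    rw [integral_add (integrable_surplus hq p b) (integrable_const _)]; simp [meanSurplus]
  rw [h1]
  refine integral_mono (integrable_surplus hq p' b)
    ((integrable_surplus hq p b).add (integrable_const _)) fun u => ?_
  simp only [surplus]; split_ifs <;> linarith

theorem continuous_meanSurplus_self (hq : IsWin q) : Continuous fun p => meanSurplus q p p := by
  refine LipschitzWith.continuous (K := 1) (LipschitzWith.of_dist_le_mul fun p p' => ?_)
  simpa [Real.dist_eq] using abs_meanSurplus_self_sub_le hq p p'

theorem volume_real_priceToBeat_lt (hq : IsWin q) (b : ℝ) :
    volume.real {u : I | priceToBeat q u < (b : EReal)} = q b := by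
  rw [Measure.real, volume_priceToBeat_lt hq.mono hq.cont hq.nonneg hq.le_one b,
    ENNReal.toReal_ofReal (hq.nonneg b)]

theorem measurableSet_win (q : ℝ → ℝ) (b : ℝ) :
    MeasurableSet {u : I | priceToBeat q u < (b : EReal)} :=
  measurableSet_lt (measurable_priceToBeat q) measurable_const

/-- Underbidding and overbidding are penalized by the square of the deviation. -/
theorem meanSurplus_self_sub_le (hq : IsWin q) (p b : ℝ) :
    meanSurplus q p p - meanSurplus q p b ≤ (p - b) * (q p - q b) := by
  set W : ℝ → Set I := fun b => {u : I | priceToBeat q u < (b : EReal)}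
  have hint : ∀ b, Integrable ((W b).indicator fun _ => (1 : ℝ)) := fun b =>
    (integrable_const 1).indicator (measurableSet_win q b)
  have hW : ∀ b, ∫ u, (W b).indicator (fun _ => (1 : ℝ)) u = q b := fun b => by
    rw [integral_indicator_const _ (measurableSet_win q b), volume_real_priceToBeat_lt hq]; simp
  have h : (p - b) * (q p - q b) = ∫ u, (p - b) *
      ((W p).indicator (fun _ => (1 : ℝ)) u - (W b).indicator (fun _ => (1 : ℝ)) u) := by
    rw [integral_const_mul, integral_sub (hint p) (hint b), hW, hW]
  rw [h, meanSurplus, meanSurplus,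
    ← integral_sub (integrable_surplus hq p p) (integrable_surplus hq p b)]
  refine integral_mono_ae ((integrable_surplus hq p p).sub (integrable_surplus hq p b))
    (((hint p).sub (hint b)).const_mul _) (ae_pos_unitInterval.mono fun u hu => ?_)
  simp only [surplus, Set.indicator_apply, W, Set.mem_ofPred_eq]
  -- If only one of the bids `p`, `b` wins, the price lies between them, so the loss is at most `|p
  -- - b|`; otherwise there is no loss.
  rcases hq.price_cases hu with h | ⟨x, h0, h1, h⟩
  · simp [h]
  · simp only [h, EReal.coe_lt_coe_iff, EReal.toReal_coe]
    split_ifs <;> linarith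

/-- Layer-cake formula: the truthful surplus exceeds `s > 0` exactly when the price is below `p -
s`. In particular only `q` on `[0, p]` matters, which is why closeness on `[0, β]` suffices later.
-/
theorem meanSurplus_self_eq_integral (hq : IsWin q) (p : ℝ) :
    meanSurplus q p p = ∫ s in Set.Ioc 0 p, q (p - s) := by
  have hnn : 0 ≤ᵐ[volume] surplus q p p := ae_pos_unitInterval.mono fun u hu => by
    rcases surplus_cases hq hu with h | ⟨x, h0, h1, h⟩
    · simp [h]
    · rw [h]; simp only [Pi.zero_apply]; split_ifs <;> linarith
  rw [meanSurplus, (integrable_surplus hq p p).integral_eq_integral_meas_lt hnn]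
  have h1 : ∀ s ∈ Set.Ioi (0 : ℝ), volume.real {u : I | s < surplus q p p u} = q (p - s) := by
    intro s hs
    rw [← volume_real_priceToBeat_lt hq]
    refine measureReal_congr (ae_pos_unitInterval.mono fun u hu => propext ?_)
    change s < surplus q p p u ↔ priceToBeat q u < ((p - s : ℝ) : EReal)
    have hs' : 0 < s := hs
    rcases hq.price_cases hu with h | ⟨x, h0, h1, h⟩
    · simp [surplus, h, hs'.le]
    · simp only [surplus, h, EReal.coe_lt_coe_iff, EReal.toReal_coe]
      split_ifs
      · constructor <;> intro <;> linarith
      · constructor <;> intro <;> linarith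
  rw [setIntegral_congr_fun measurableSet_Ioi h1]
  refine (setIntegral_eq_of_subset_of_forall_sdiff_eq_zero measurableSet_Ioi
    Set.Ioc_subset_Ioi_self fun s hs => hq.nonpos _ ?_)
  have := hs.2
  simp only [Set.mem_Ioc, not_and, not_le] at this
  linarith [this hs.1]

theorem meanSurplus_self_nonpos (hq : IsWin q) {p : ℝ} (hp : p ≤ 0) : meanSurplus q p p = 0 := by
  rw [meanSurplus_self_eq_integral hq, Set.Ioc_eq_empty (not_lt.2 hp)]; simp

theorem meanSurplus_self_nonneg (hq : IsWin q) (p : ℝ) : 0 ≤ meanSurplus q p p := by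
  rw [meanSurplus_self_eq_integral hq]
  exact integral_nonneg fun s => hq.nonneg _

theorem abs_meanSurplus_sub_le {q' : ℝ → ℝ} (hq : IsWin q) (hq' : IsWin q') {ε β p : ℝ}
    (hε : 0 ≤ ε) (hp0 : 0 ≤ p) (hp : p ≤ β) (h : ∀ v ∈ Set.Icc 0 β, |q v - q' v| ≤ ε) :
    |meanSurplus q p p - meanSurplus q' p p| ≤ ε * β := by
  have hint : ∀ {q : ℝ → ℝ}, IsWin q → IntegrableOn (fun s => q (p - s)) (Set.Ioc 0 p) :=
    fun {q} hq => ((hq.cont.comp (by fun_prop)).integrableOn_Icc).mono_set Set.Ioc_subset_Icc_self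
  rw [meanSurplus_self_eq_integral hq, meanSurplus_self_eq_integral hq',
    ← integral_sub (hint hq) (hint hq')]
  have h2 := norm_setIntegral_le_of_norm_le_const (μ := volume) (s := Set.Ioc 0 p) (C := ε)
    (f := fun s => q (p - s) - q' (p - s)) (by simp)
    (fun s hs => h _ ⟨by linarith [hs.2], by linarith [hs.1]⟩)
  refine h2.trans ?_
  rw [Real.volume_real_Ioc_of_le hp0]
  exact mul_le_mul_of_nonneg_left (by linarith) hε

end

/-! ### The renewal equation -/

section

variable (q : ℝ → ℝ) (π : ℝ≥0 → ℝ≥0)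

/-- The elapsed time just after an auction with waiting time `z.1` and seed `z.2`. -/
def next (τ : ℝ≥0) (z : ℝ × I) : ℝ≥0 :=
  open Classical in
  if priceToBeat q z.2 < ((π (τ + z.1.toNNReal) : ℝ) : EReal) then 0 else τ + z.1.toNNReal

/-- Renewal structure: after the first auction is settled, ages evolve as in a fresh episode started
at `next`. -/
theorem age_consSeq (τ : ℝ≥0) (z : ℝ × I) (x : ℕ → ℝ × I) (l l' : ℝ) (n : ℕ) :
    age q π τ (consSeq (z, x), l) (n + 1) = age q π (next q π τ z) (x, l') n := by
  induction n with
  | zero => rfl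
  | succ n ih => rw [age, ih, age]; rfl

/-- Ages ignore the episode length, which justifies the dummy length `0` in `seqTerm`. -/
theorem age_congr (τ : ℝ≥0) (x : ℕ → ℝ × I) (l l' : ℝ) (n : ℕ) :
    age q π τ (x, l) n = age q π τ (x, l') n := by
  induction n with
  | zero => rfl
  | succ n ih => rw [age, ih, age]

variable {π}

theorem measurable_next (hπ : Measurable π) :
    Measurable fun p : ℝ≥0 × (ℝ × I) => next q π p.1 p.2 := by
  have h : Measurable fun p : ℝ≥0 × (ℝ × I) => p.1 + p.2.1.toNNReal := by fun_prop
  refine Measurable.ite (measurableSet_lt ?_ ?_) measurable_const h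
  · exact (measurable_priceToBeat q).comp (by fun_prop)
  · exact (hπ.comp h).coe_nnreal_real.coe_real_ereal

theorem measurable_age (hπ : Measurable π) (n : ℕ) :
    Measurable fun p : ℝ≥0 × (ℕ → ℝ × I) => age q π p.1 (p.2, 0) n := by
  induction n with
  | zero =>
    simp only [age]
    fun_prop
  | succ n ih =>
    simp only [age]
    refine Measurable.add (Measurable.ite (measurableSet_lt ?_ ?_) measurable_const ih) ?_
    · exact (measurable_priceToBeat q).comp (by fun_prop)
    · exact (hπ.comp ih).coe_nnreal_real.coe_real_ereal
    · fun_prop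

end

section

variable (k q : ℝ → ℝ) (π : ℝ≥0 → ℝ≥0)

/-- The payoff of auction `n`, irrespective of the end of the episode. -/
def seqTerm (n : ℕ) (τ : ℝ≥0) (x : ℕ → ℝ × I) : ℝ :=
  surplus q (k (age q π τ (x, 0) n)) (π (age q π τ (x, 0) n)) (x n).2

theorem seqTerm_zero_consSeq (τ : ℝ≥0) (z : ℝ × I) (x : ℕ → ℝ × I) :
    seqTerm k q π 0 τ (consSeq (z, x))
      = surplus q (k ↑(τ + z.1.toNNReal)) (π (τ + z.1.toNNReal)) z.2 := rfl

theorem seqTerm_succ_consSeq (n : ℕ) (τ : ℝ≥0) (z : ℝ × I) (x : ℕ → ℝ × I) :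
    seqTerm k q π (n + 1) τ (consSeq (z, x)) = seqTerm k q π n (next q π τ z) x := by
  unfold seqTerm
  rw [age_consSeq q π τ z x 0 0 n]
  rfl

theorem payoff_eq (τ : ℝ≥0) (ω : Episode) :
    payoff k q π τ ω
      = ∑' n, {ω : Episode | arrival ω n ≤ ω.2}.indicator (fun ω => seqTerm k q π n τ ω.1) ω := by
  refine tsum_congr fun n => ?_
  obtain ⟨x, l⟩ := ω
  simp only [Wins, seqTerm, surplus, Set.indicator_apply, Set.mem_ofPred_eq,
    age_congr q π τ x l 0 n]
  by_cases h : arrival (x, l) n ≤ l <;> simp [h]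

variable {k q π}

theorem measurable_seqTerm (hk : Measurable k) (hπ : Measurable π) (n : ℕ) :
    Measurable fun p : ℝ≥0 × (ℕ → ℝ × I) => seqTerm k q π n p.1 p.2 := by
  have h := measurable_age q hπ n
  exact measurable_surplus q (hk.comp h.coe_nnreal_real) (hπ.comp h).coe_nnreal_real (by fun_prop)

theorem abs_seqTerm_le (hq : IsWin q) {K : ℝ} (hK : ∀ a : ℝ≥0, |k a| ≤ K) (n : ℕ) (τ : ℝ≥0)
    (x : ℕ → ℝ × I) : |seqTerm k q π n τ x| ≤ K + hq.bound :=
  (abs_surplus_le hq _ _ _).trans (by have := hK (age q π τ (x, 0) n); linarith)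

/-- The discounted expected payoff of auction `n`. -/
def auctionValue (μ γ : ℝ) (k q : ℝ → ℝ) (π : ℝ≥0 → ℝ≥0) (n : ℕ) (τ : ℝ≥0) : ℝ :=
  ∫ x, discProd γ n x * seqTerm k q π n τ x ∂(seqLaw μ)

variable {μ γ K : ℝ}

theorem measurable_auctionValue (hμ : 0 < μ) (hk : Measurable k) (hπ : Measurable π) (n : ℕ) :
    Measurable (auctionValue μ γ k q π n) := by
  have := isProbabilityMeasure_seqLaw hμ
  have h : Measurable fun p : ℝ≥0 × (ℕ → ℝ × I) => discProd γ n p.2 * seqTerm k q π n p.1 p.2 :=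
    ((measurable_discProd γ n).comp measurable_snd).mul (measurable_seqTerm hk hπ n)
  exact (h.stronglyMeasurable.integral_prod_right).measurable

theorem abs_discProd_mul_seqTerm_le (hq : IsWin q) (hK : ∀ a : ℝ≥0, |k a| ≤ K)
    (n : ℕ) (τ : ℝ≥0) (x : ℕ → ℝ × I) :
    |discProd γ n x * seqTerm k q π n τ x| ≤ (K + hq.bound) * discProd γ n x := by
  rw [abs_mul, abs_of_nonneg (discProd_nonneg γ n x), mul_comm]
  exact mul_le_mul_of_nonneg_right (abs_seqTerm_le hq hK n τ x) (discProd_nonneg γ n x)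

theorem integrable_discProd (hμ : 0 < μ) (hγ : 0 < γ) (n : ℕ) :
    Integrable (discProd γ n) (seqLaw μ) := by
  have := isProbabilityMeasure_seqLaw hμ
  exact Integrable.of_bound (by fun_prop) 1 (ae_of_all _ fun x => abs_discProd_le_one hγ n x)

theorem abs_auctionValue_le (hμ : 0 < μ) (hγ : 0 < γ) (hq : IsWin q) (hK : ∀ a : ℝ≥0, |k a| ≤ K)
    (n : ℕ) (τ : ℝ≥0) :
    |auctionValue μ γ k q π n τ| ≤ (K + hq.bound) * rho μ γ ^ (n + 1) := by
  rw [← integral_discProd hμ hγ n, ← integral_const_mul]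
  exact norm_integral_le_of_norm_le (f := fun x => discProd γ n x * seqTerm k q π n τ x)
    ((integrable_discProd hμ hγ n).const_mul _) (ae_of_all _ fun x => abs_discProd_mul_seqTerm_le hq hK n τ x)

theorem bound_add_nonneg (hq : IsWin q) (hK : ∀ a : ℝ≥0, |k a| ≤ K) : 0 ≤ K + hq.bound :=
  add_nonneg ((abs_nonneg _).trans (hK 0)) hq.bound_nonneg

theorem abs_discProd_mul_seqTerm_le' (hγ : 0 < γ) (hq : IsWin q) (hK : ∀ a : ℝ≥0, |k a| ≤ K)
    (n : ℕ) (τ : ℝ≥0) (x : ℕ → ℝ × I) :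
    |discProd γ n x * seqTerm k q π n τ x| ≤ K + hq.bound :=
  (abs_discProd_mul_seqTerm_le hq hK n τ x).trans
    (mul_le_of_le_one_right (bound_add_nonneg hq hK) (discProd_le_one hγ n x))

theorem measurable_discProd_mul_seqTerm (hk : Measurable k) (hπ : Measurable π) (n : ℕ) (τ : ℝ≥0) :
    Measurable fun x => discProd γ n x * seqTerm k q π n τ x :=
  (measurable_discProd γ n).mul ((measurable_seqTerm hk hπ n).comp (measurable_prodMk_left))

theorem auctionValue_zero (hμ : 0 < μ) (hγ : 0 < γ) (hk : Measurable k) (hq : IsWin q)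
    (hK : ∀ a : ℝ≥0, |k a| ≤ K) (hπ : Measurable π) (τ : ℝ≥0) :
    auctionValue μ γ k q π 0 τ = ∫ z, disc γ z.1 *
      surplus q (k ↑(τ + z.1.toNNReal)) (π (τ + z.1.toNNReal)) z.2 ∂(stepLaw μ) := by
  have := isProbabilityMeasure_stepLaw hμ
  rw [auctionValue, seqLaw, integral_infinitePi_eq_consSeq _
    (measurable_discProd_mul_seqTerm hk hπ 0 τ) (abs_discProd_mul_seqTerm_le' hγ hq hK 0 τ)]
  simp [seqTerm_zero_consSeq, discProd_zero_consSeq]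

theorem auctionValue_succ (hμ : 0 < μ) (hγ : 0 < γ) (hk : Measurable k) (hq : IsWin q)
    (hK : ∀ a : ℝ≥0, |k a| ≤ K) (hπ : Measurable π) (n : ℕ) (τ : ℝ≥0) :
    auctionValue μ γ k q π (n + 1) τ
      = ∫ z, disc γ z.1 * auctionValue μ γ k q π n (next q π τ z) ∂(stepLaw μ) := by
  have := isProbabilityMeasure_stepLaw hμ
  rw [auctionValue, seqLaw, integral_infinitePi_eq_consSeq _
    (measurable_discProd_mul_seqTerm hk hπ (n + 1) τ)
    (abs_discProd_mul_seqTerm_le' hγ hq hK (n + 1) τ)]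
  simp only [seqTerm_succ_consSeq, discProd_succ_consSeq, mul_assoc, integral_const_mul]
  rfl

/-! ### Policy values as discounted series, and their recursion -/

theorem measurable_arrival (n : ℕ) : Measurable fun ω : Episode => arrival ω n := by
  unfold arrival; fun_prop

theorem measurableSet_arrival_le (n : ℕ) : MeasurableSet {ω : Episode | arrival ω n ≤ ω.2} :=
  measurableSet_le (measurable_arrival n) measurable_snd

theorem integral_indicator_arrival (hμ : 0 < μ) (hγ : 0 < γ) (n : ℕ) {f : (ℕ → ℝ × I) → ℝ}
    (hf : Measurable f) {M : ℝ} (hM : ∀ x, |f x| ≤ M) :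
    ∫ ω, {ω : Episode | arrival ω n ≤ ω.2}.indicator (fun ω => f ω.1) ω ∂(episodeLaw μ γ)
      = ∫ x, discProd γ n x * f x ∂(seqLaw μ) := by
  have := isProbabilityMeasure_seqLaw hμ
  have := isProbabilityMeasure_expMeasure hγ
  rw [episodeLaw_eq, integral_prod]
  · refine integral_congr_ae ((measure_arrival_le hμ hγ n).mono fun x hx => ?_)
    have h : ∀ l : ℝ, {ω : Episode | arrival ω n ≤ ω.2}.indicator (fun ω => f ω.1) (x, l)
        = {l : ℝ | arrival (x, l) n ≤ l}.indicator (fun _ => f x) l := fun l => rfl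
    simp only [h]
    rw [integral_indicator_const, hx, smul_eq_mul]
    exact (measurableSet_arrival_le n).preimage measurable_prodMk_left
  · refine Integrable.of_bound (C := M) ?_ (ae_of_all _ fun ω => ?_)
    · exact ((hf.comp measurable_fst).indicator
        (measurableSet_arrival_le n)).aestronglyMeasurable
    · exact (norm_indicator_le_norm_self _ _).trans (hM _)

/-- Bounded payoffs and geometric discounting make the integrals of the absolute values summable, so
sum and expectation commute. -/
theorem hasSum_auctionValue (hμ : 0 < μ) (hγ : 0 < γ) (hk : Measurable k) (hq : IsWin q)
    (hK : ∀ a : ℝ≥0, |k a| ≤ K) (hπ : Measurable π) (τ : ℝ≥0) :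
    HasSum (fun n => auctionValue μ γ k q π n τ) (policyValue μ γ k q π τ) := by
  have := isProbabilityMeasure_seqLaw hμ
  have := isProbabilityMeasure_expMeasure hγ
  have hprob : IsProbabilityMeasure (episodeLaw μ γ) := by rw [episodeLaw_eq]; infer_instance
  have hm : ∀ n, Measurable (seqTerm k q π n τ) := fun n =>
    (measurable_seqTerm hk hπ n).comp measurable_prodMk_left
  have hint : ∀ n, Integrable ({ω : Episode | arrival ω n ≤ ω.2}.indicator
      (fun ω => seqTerm k q π n τ ω.1)) (episodeLaw μ γ) := fun n => by
    refine Integrable.of_bound (C := K + hq.bound) ?_ (ae_of_all _ fun ω => ?_)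
    · exact (((hm n).comp measurable_fst).indicator
        (measurableSet_arrival_le n)).aestronglyMeasurable
    · exact (norm_indicator_le_norm_self _ _).trans (abs_seqTerm_le hq hK n τ _)
  have hnorm : ∀ n, ∫ ω, ‖{ω : Episode | arrival ω n ≤ ω.2}.indicator
      (fun ω => seqTerm k q π n τ ω.1) ω‖ ∂(episodeLaw μ γ)
        ≤ (K + hq.bound) * rho μ γ ^ (n + 1) := fun n => by
    simp only [norm_indicator_eq_indicator_norm, Real.norm_eq_abs]
    rw [integral_indicator_arrival hμ hγ n (f := fun x => |seqTerm k q π n τ x|) (hm n).abs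
      (M := K + hq.bound) (fun x => by rw [abs_abs]; exact abs_seqTerm_le hq hK n τ x),
      ← integral_discProd hμ hγ n, ← integral_const_mul]
    refine integral_mono_of_nonneg
      (ae_of_all _ fun x => mul_nonneg (discProd_nonneg γ n x) (abs_nonneg _))
      ((integrable_discProd hμ hγ n).const_mul _) (ae_of_all _ fun x => ?_)
    have h := abs_discProd_mul_seqTerm_le (γ := γ) (π := π) hq hK n τ x
    rwa [abs_mul, abs_of_nonneg (discProd_nonneg γ n x)] at h
  have hsum : Summable fun n => (K + hq.bound) * rho μ γ ^ (n + 1) :=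
    ((summable_nat_add_iff 1).2
      (summable_geometric_of_lt_one (rho_nonneg μ γ) (rho_lt_one hμ hγ))).mul_left _
  have h := hasSum_integral_of_summable_integral_norm hint
    (Summable.of_nonneg_of_le (fun n => integral_nonneg fun ω => norm_nonneg _) hnorm hsum)
  have hpay : policyValue μ γ k q π τ = ∫ ω, ∑' n, {ω : Episode | arrival ω n ≤ ω.2}.indicator
      (fun ω => seqTerm k q π n τ ω.1) ω ∂(episodeLaw μ γ) :=
    integral_congr_ae (ae_of_all _ fun ω => payoff_eq k q π τ ω)
  have hval : (fun n => auctionValue μ γ k q π n τ) = fun n => ∫ ω, {ω : Episode |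
      arrival ω n ≤ ω.2}.indicator (fun ω => seqTerm k q π n τ ω.1) ω ∂(episodeLaw μ γ) :=
    funext fun n =>
      (integral_indicator_arrival hμ hγ n (hm n) fun x => abs_seqTerm_le hq hK n τ x).symm
  rw [hpay, hval]
  exact h

theorem abs_policyValue_le (hμ : 0 < μ) (hγ : 0 < γ) (hk : Measurable k) (hq : IsWin q)
    (hK : ∀ a : ℝ≥0, |k a| ≤ K) (hπ : Measurable π) (τ : ℝ≥0) :
    |policyValue μ γ k q π τ| ≤ (K + hq.bound) * (1 - rho μ γ)⁻¹ := by
  have h := hasSum_auctionValue hμ hγ hk hq hK hπ τ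
  have hg := (hasSum_geometric_of_lt_one (rho_nonneg μ γ) (rho_lt_one hμ hγ)).mul_left
    (K + hq.bound)
  rw [← h.tsum_eq]
  refine tsum_of_norm_bounded (f := fun n => auctionValue μ γ k q π n τ) hg
    fun n => (abs_auctionValue_le hμ hγ hq hK n τ).trans ?_
  exact mul_le_mul_of_nonneg_left
    (pow_le_pow_of_le_one (rho_nonneg μ γ) (rho_lt_one hμ hγ).le n.le_succ)
    (bound_add_nonneg hq hK)

theorem measurable_policyValue (hμ : 0 < μ) (hγ : 0 < γ) (hk : Measurable k) (hq : IsWin q)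
    (hK : ∀ a : ℝ≥0, |k a| ≤ K) (hπ : Measurable π) : Measurable (policyValue μ γ k q π) := by
  have h : policyValue μ γ k q π = fun τ => ∑' n, auctionValue μ γ k q π n τ :=
    funext fun τ => (hasSum_auctionValue hμ hγ hk hq hK hπ τ).tsum_eq.symm
  rw [h]
  exact measurable_of_tendsto_metrizable
    (fun n => Finset.measurable_sum (Finset.range n) fun i _ => measurable_auctionValue hμ hk hπ i)
    (tendsto_pi_nhds.2 fun τ => by
      have h2 := (hasSum_auctionValue hμ hγ hk hq hK hπ τ)
      rw [← h2.tsum_eq] at h2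
      simpa using h2.tendsto_sum_nat)

theorem policyValue_eq_stepLaw (hμ : 0 < μ) (hγ : 0 < γ) (hk : Measurable k) (hq : IsWin q)
    (hK : ∀ a : ℝ≥0, |k a| ≤ K) (hπ : Measurable π) (τ : ℝ≥0) :
    policyValue μ γ k q π τ = ∫ z, disc γ z.1 *
      (surplus q (k ↑(τ + z.1.toNNReal)) (π (τ + z.1.toNNReal)) z.2
        + policyValue μ γ k q π (next q π τ z)) ∂(stepLaw μ) := by
  have := isProbabilityMeasure_stepLaw hμ
  have hnext : Measurable (next q π τ) := (measurable_next q hπ).comp measurable_prodMk_left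
  have hd : Measurable fun z : ℝ × I => disc γ z.1 := by fun_prop
  have hM := bound_add_nonneg hq hK
  have hmul : ∀ {z : ℝ × I} {y M : ℝ}, |y| ≤ M → ‖disc γ z.1 * y‖ ≤ M := fun {z y M} hy => by
    rw [norm_mul, Real.norm_eq_abs, Real.norm_eq_abs]
    exact (mul_le_of_le_one_left (abs_nonneg y) (abs_disc_le_one hγ z.1)).trans hy
  have h := hasSum_auctionValue hμ hγ hk hq hK hπ τ
  have hsum : HasSum (fun n => auctionValue μ γ k q π (n + 1) τ)
      (∫ z, disc γ z.1 * policyValue μ γ k q π (next q π τ z) ∂(stepLaw μ)) := by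
    have hr : ∀ n : ℕ, rho μ γ ^ (n + 1) ≤ rho μ γ ^ n := fun n =>
      pow_le_pow_of_le_one (rho_nonneg μ γ) (rho_lt_one hμ hγ).le n.le_succ
    have hb : ∀ (n : ℕ) (z : ℝ × I),
        ‖disc γ z.1 * auctionValue μ γ k q π n (next q π τ z)‖
          ≤ (K + hq.bound) * rho μ γ ^ n := fun n z =>
      hmul ((abs_auctionValue_le hμ hγ hq hK n _).trans (mul_le_mul_of_nonneg_left (hr n) hM))
    have hm : ∀ n, Measurable fun z : ℝ × I =>
        disc γ z.1 * auctionValue μ γ k q π n (next q π τ z) := fun n =>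
      hd.mul ((measurable_auctionValue hμ hk hπ n).comp hnext)
    have h2 := hasSum_integral_of_summable_integral_norm (μ := stepLaw μ)
      (fun n => Integrable.of_bound (hm n).aestronglyMeasurable _ (ae_of_all _ (hb n)))
      (Summable.of_nonneg_of_le (fun n => integral_nonneg fun ω => norm_nonneg _)
        (fun n => (integral_mono_of_nonneg (ae_of_all _ fun _ => norm_nonneg _)
          (integrable_const _) (ae_of_all _ (hb n))).trans (by simp))
        ((summable_geometric_of_lt_one (rho_nonneg μ γ) (rho_lt_one hμ hγ)).mul_left
          (K + hq.bound)))
    simp only [← auctionValue_succ hμ hγ hk hq hK hπ] at h2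
    have htsum : ∀ z : ℝ × I, ∑' n, disc γ z.1 * auctionValue μ γ k q π n (next q π τ z)
        = disc γ z.1 * policyValue μ γ k q π (next q π τ z) := fun z => by
      rw [tsum_mul_left, (hasSum_auctionValue hμ hγ hk hq hK hπ _).tsum_eq]
    simp only [htsum] at h2
    exact h2
  rw [← h.tsum_eq, h.summable.tsum_eq_zero_add, hsum.tsum_eq, auctionValue_zero hμ hγ hk hq hK hπ,
    ← integral_add]
  · simp only [mul_add]
  · refine Integrable.of_bound (C := K + hq.bound) ?_ (ae_of_all _ fun z => hmul ?_)
    · have ha : Measurable fun z : ℝ × I => τ + z.1.toNNReal := by fun_prop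
      exact (hd.mul (measurable_surplus q (hk.comp ha.coe_nnreal_real)
        (hπ.comp ha).coe_nnreal_real (by fun_prop))).aestronglyMeasurable
    · exact (abs_surplus_le hq _ _ _).trans (by have := hK (τ + z.1.toNNReal); linarith)
  · refine Integrable.of_bound ?_ _ (ae_of_all _ fun z =>
      hmul (abs_policyValue_le hμ hγ hk hq hK hπ _))
    exact (hd.mul ((measurable_policyValue hμ hγ hk hq hK hπ).comp hnext)).aestronglyMeasurable

/-- The discounted mean of `f` at the next auction. -/
def stepMean (μ γ : ℝ) (f : ℝ≥0 → ℝ) (τ : ℝ≥0) : ℝ :=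
  ∫ s, disc γ s * f (τ + s.toNNReal) ∂(expMeasure μ)

/-- The value of continuing with `V` after an auction at elapsed time `a`. -/
def continuation (k q : ℝ → ℝ) (π : ℝ≥0 → ℝ≥0) (V : ℝ≥0 → ℝ) (a : ℝ≥0) : ℝ :=
  V a + meanSurplus q (k a + V 0 - V a) (π a)

theorem policyValue_eq_stepMean (hμ : 0 < μ) (hγ : 0 < γ) (hk : Measurable k) (hq : IsWin q)
    (hK : ∀ a : ℝ≥0, |k a| ≤ K) (hπ : Measurable π) (τ : ℝ≥0) :
    policyValue μ γ k q π τ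
      = stepMean μ γ (continuation k q π (policyValue μ γ k q π)) τ := by
  have := isProbabilityMeasure_expMeasure hμ
  set V := policyValue μ γ k q π with hV
  have hVm : Measurable V := measurable_policyValue hμ hγ hk hq hK hπ
  set M := (K + hq.bound) * (1 - rho μ γ)⁻¹
  have hVM : ∀ a, |V a| ≤ M := abs_policyValue_le hμ hγ hk hq hK hπ
  -- A win resets the age, replacing `V a` by `V 0`; charging this change to the object turns its
  -- worth into `k a + V 0 - V a`.
  have hpt : ∀ z : ℝ × I, surplus q (k ↑(τ + z.1.toNNReal)) (π (τ + z.1.toNNReal)) z.2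
      + V (next q π τ z) = V (τ + z.1.toNNReal) + surplus q
        (k ↑(τ + z.1.toNNReal) + V 0 - V (τ + z.1.toNNReal)) (π (τ + z.1.toNNReal)) z.2 := by
    intro z
    unfold surplus next
    split_ifs
    · ring
    · ring
  have ha : Measurable fun z : ℝ × I => τ + z.1.toNNReal := by fun_prop
  have hd : Measurable fun z : ℝ × I => disc γ z.1 := by fun_prop
  rw [hV, policyValue_eq_stepLaw hμ hγ hk hq hK hπ τ, ← hV]
  simp only [hpt]
  rw [stepLaw, integral_prod]
  · simp only [stepMean, continuation, meanSurplus, integral_const_mul]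
    refine integral_congr_ae (ae_of_all _ fun s => ?_)
    simp only []
    rw [integral_add (integrable_const _) (integrable_surplus hq _ _)]
    simp
  · refine Integrable.of_bound (C := M + (K + M + M + hq.bound)) ?_ (ae_of_all _ fun z => ?_)
    · refine (hd.mul ((hVm.comp ha).add ?_)).aestronglyMeasurable
      exact measurable_surplus q (((hk.comp ha.coe_nnreal_real).add_const _).sub (hVm.comp ha))
        (hπ.comp ha).coe_nnreal_real (by fun_prop)
    · rw [norm_mul, Real.norm_eq_abs, Real.norm_eq_abs]
      refine (mul_le_of_le_one_left (abs_nonneg _) (abs_disc_le_one hγ z.1)).trans ?_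
      refine (abs_add_le _ _).trans (add_le_add (hVM _) ((abs_surplus_le hq _ _ _).trans ?_))
      refine add_le_add_left ((abs_sub _ _).trans (add_le_add ((abs_add_le _ _).trans ?_) (hVM _))) _
      exact add_le_add (hK _) (hVM 0)

end

/-! ### The Bellman equation -/

/-- The properties of value functions that the analysis uses. -/
structure IsVal (k : ℝ → ℝ) : Prop where
  mono : Monotone k
  cont : Continuous k
  zero : 0 ≤ k 0
  bdd : ∃ K, ∀ x, k x ≤ K
  concave : ∀ x y h, 0 ≤ x → x ≤ y → 0 ≤ h → k (y + h) - k y ≤ k (x + h) - k x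

section

variable {k q : ℝ → ℝ} {μ γ : ℝ}

theorem IsVal.nonneg (hk : IsVal k) (a : ℝ≥0) : 0 ≤ k a := hk.zero.trans (hk.mono a.2)

theorem IsVal.exists_abs_le (hk : IsVal k) : ∃ K, ∀ a : ℝ≥0, |k a| ≤ K := by
  obtain ⟨K, hK⟩ := hk.bdd
  exact ⟨K, fun a => by rw [abs_of_nonneg (hk.nonneg a)]; exact hK _⟩

theorem integrable_disc_mul (hμ : 0 < μ) (hγ : 0 < γ) {f : ℝ≥0 → ℝ} (hf : Measurable f)
    {M : ℝ} (hM : ∀ a, |f a| ≤ M) (τ : ℝ≥0) :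
    Integrable (fun s => disc γ s * f (τ + s.toNNReal)) (expMeasure μ) := by
  have := isProbabilityMeasure_expMeasure hμ
  refine Integrable.of_bound (C := M) ?_ (ae_of_all _ fun s => ?_)
  · exact ((measurable_disc γ).mul (hf.comp (by fun_prop))).aestronglyMeasurable
  · rw [norm_mul, Real.norm_eq_abs, Real.norm_eq_abs]
    exact (mul_le_of_le_one_left (abs_nonneg _) (abs_disc_le_one hγ s)).trans (hM _)

/-- The contraction step: a gap `D` at the next auction is worth `rho * D` now. Distinct starting
ages are allowed so that it can also bound increments of one function. -/
theorem stepMean_le_add (hμ : 0 < μ) (hγ : 0 < γ) {f g : ℝ≥0 → ℝ} (hf : Measurable f)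
    (hg : Measurable g) {M M' : ℝ} (hM : ∀ a, |f a| ≤ M) (hM' : ∀ a, |g a| ≤ M') {D : ℝ}
    {τ τ' : ℝ≥0} (h : ∀ s : ℝ≥0, f (τ + s) ≤ g (τ' + s) + D) :
    stepMean μ γ f τ ≤ stepMean μ γ g τ' + rho μ γ * D := by
  have hg' := integrable_disc_mul hμ hγ hg hM' τ'
  have hD := (integrable_disc hμ hγ).mul_const D
  rw [stepMean, stepMean, rho, ← integral_mul_const, ← integral_add hg' hD]
  refine integral_mono (integrable_disc_mul hμ hγ hf hM τ) (hg'.add hD) fun s => ?_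
  simp only [← mul_add]
  exact mul_le_mul_of_nonneg_left (h _) (disc_pos γ s).le

theorem continuous_stepMean (hμ : 0 < μ) (hγ : 0 < γ) {f : ℝ≥0 → ℝ} (hf : Continuous f)
    {M : ℝ} (hM : ∀ a, |f a| ≤ M) : Continuous (stepMean μ γ f) := by
  have := isProbabilityMeasure_expMeasure hμ
  refine continuous_of_dominated (bound := fun _ => M)
    (fun τ => (integrable_disc_mul hμ hγ hf.measurable hM τ).aestronglyMeasurable)
    (fun τ => ae_of_all _ fun s => ?_) (integrable_const _) (ae_of_all _ fun s => by fun_prop)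
  rw [norm_mul, Real.norm_eq_abs, Real.norm_eq_abs]
  exact (mul_le_of_le_one_left (abs_nonneg _) (abs_disc_le_one hγ s)).trans (hM _)

theorem stepMean_zero (τ : ℝ≥0) : stepMean μ γ (fun _ => 0) τ = 0 := by simp [stepMean]

/-- A function that is bounded above and satisfies a contractive estimate is small. -/
theorem le_of_contractive (hμ : 0 < μ) (hγ : 0 < γ) {D : ℝ≥0 → ℝ} (hD : ∃ M, ∀ τ, D τ ≤ M)
    {δ : ℝ} (hδ : 0 ≤ δ)
    (h : ∀ M, 0 ≤ M → (∀ τ, D τ ≤ M) → ∀ τ, D τ ≤ rho μ γ * M + δ) (τ : ℝ≥0) :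
    D τ ≤ δ / (1 - rho μ γ) := by
  obtain ⟨M, hM⟩ := hD
  have hbdd : BddAbove (Set.range D) := ⟨M, by rintro _ ⟨τ, rfl⟩; exact hM τ⟩
  -- The positive part of the supremum is an admissible `M`, so it satisfies `M ≤ rho * M + δ`.
  have hle : ∀ τ, D τ ≤ max 0 (⨆ τ, D τ) := fun τ => (le_ciSup hbdd τ).trans (le_max_right _ _)
  have h1 := h _ (le_max_left _ _) hle
  have h2 : max 0 (⨆ τ, D τ) ≤ rho μ γ * max 0 (⨆ τ, D τ) + δ :=
    max_le (add_nonneg (mul_nonneg (rho_nonneg _ _) (le_max_left _ _)) hδ) (ciSup_le h1)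
  have h3 := rho_lt_one hμ hγ
  rw [le_div_iff₀ (by linarith)]
  nlinarith [hle τ]

/-- The value of continuing with `V` after bidding optimally at elapsed time `a`. -/
def optContinuation (k q : ℝ → ℝ) (V : ℝ≥0 → ℝ) (a : ℝ≥0) : ℝ :=
  V a + meanSurplus q (k a + V 0 - V a) (k a + V 0 - V a)

/-- With slopes of `F` in `[0, 1]`, `v + F (w - v)` is nondecreasing in both `v` and `w`, and adding
`E` to both adds exactly `E`. -/
theorem add_le_add_of_slope {F : ℝ → ℝ} (hF : ∀ p p', p ≤ p' → F p ≤ F p')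
    (hF' : ∀ p p', p ≤ p' → F p' ≤ F p + (p' - p)) {v v' w w' E : ℝ} (hv : v ≤ v' + E)
    (hw : w ≤ w' + E) : v + F (w - v) ≤ v' + F (w' - v') + E := by
  rcases le_total (w - v) (w' - v') with h | h
  · linarith [hF _ _ h]
  · linarith [hF' _ _ h]

theorem add_meanSurplus_self_le (hq : IsWin q) {v v' w w' E : ℝ} (hv : v ≤ v' + E)
    (hw : w ≤ w' + E) :
    v + meanSurplus q (w - v) (w - v) ≤ v' + meanSurplus q (w' - v') (w' - v') + E :=
  add_le_add_of_slope (F := fun p => meanSurplus q p p) (fun _ _ => meanSurplus_self_mono hq)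
    (fun _ _ => meanSurplus_self_le_add hq) hv hw

theorem add_meanSurplus_le (hq : IsWin q) (b : ℝ) {v v' w w' E : ℝ} (hv : v ≤ v' + E)
    (hw : w ≤ w' + E) : v + meanSurplus q (w - v) b ≤ v' + meanSurplus q (w' - v') b + E :=
  add_le_add_of_slope (F := fun p => meanSurplus q p b) (fun _ _ => meanSurplus_mono_left hq b)
    (fun _ _ => meanSurplus_le_add_left hq b) hv hw

theorem continuation_le_optContinuation (hq : IsWin q) (π : ℝ≥0 → ℝ≥0) (V : ℝ≥0 → ℝ) (a : ℝ≥0) :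
    continuation k q π V a ≤ optContinuation k q V a :=
  add_le_add_right (meanSurplus_le_self hq _ _) _

theorem measurable_meanSurplus {p b : ℝ≥0 → ℝ} (hp : Measurable p)
    (hb : Measurable b) : Measurable fun a => meanSurplus q (p a) (b a) := by
  have h : Measurable fun z : ℝ≥0 × I => surplus q (p z.1) (b z.1) z.2 := by fun_prop
  exact h.stronglyMeasurable.integral_prod_right.measurable

theorem abs_price_le {V : ℝ≥0 → ℝ} {K M : ℝ} (hK : ∀ a : ℝ≥0, |k a| ≤ K) (hM : ∀ a, |V a| ≤ M)
    (a : ℝ≥0) : |k a + V 0 - V a| ≤ K + M + M :=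
  (abs_sub _ _).trans (add_le_add ((abs_add_le _ _).trans (add_le_add (hK a) (hM 0))) (hM a))

theorem abs_continuation_le (hq : IsWin q) (π : ℝ≥0 → ℝ≥0) {V : ℝ≥0 → ℝ} {K M : ℝ}
    (hK : ∀ a : ℝ≥0, |k a| ≤ K) (hM : ∀ a, |V a| ≤ M) (a : ℝ≥0) :
    |continuation k q π V a| ≤ M + (K + M + M + hq.bound) :=
  (abs_add_le _ _).trans (add_le_add (hM a) ((abs_meanSurplus_le hq _ _).trans
    (by have := abs_price_le hK hM a; linarith)))

theorem abs_optContinuation_le (hq : IsWin q) {V : ℝ≥0 → ℝ} {K M : ℝ}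
    (hK : ∀ a : ℝ≥0, |k a| ≤ K) (hM : ∀ a, |V a| ≤ M) (a : ℝ≥0) :
    |optContinuation k q V a| ≤ M + (K + M + M + hq.bound) :=
  (abs_add_le _ _).trans (add_le_add (hM a) ((abs_meanSurplus_le hq _ _).trans
    (by have := abs_price_le hK hM a; linarith)))

theorem measurable_continuation (hk : IsVal k) {π : ℝ≥0 → ℝ≥0} (hπ : Measurable π)
    {V : ℝ≥0 → ℝ} (hV : Measurable V) : Measurable (continuation k q π V) :=
  hV.add (measurable_meanSurplus
    (((hk.cont.measurable.comp measurable_coe_nnreal_real).add_const _).sub hV) hπ.coe_nnreal_real)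

theorem continuous_optContinuation (hk : IsVal k) (hq : IsWin q) {V : ℝ≥0 → ℝ}
    (hV : Continuous V) : Continuous (optContinuation k q V) := by
  have hk' := hk.cont
  exact hV.add ((continuous_meanSurplus_self hq).comp (by fun_prop))

/-- A bounded continuous solution of the Bellman equation. -/
structure IsBellman (μ γ : ℝ) (k q : ℝ → ℝ) (V : ℝ≥0 → ℝ) : Prop where
  cont : Continuous V
  bdd : ∃ M, ∀ a, |V a| ≤ M
  eq : ∀ τ, V τ = stepMean μ γ (optContinuation k q V) τ

theorem abs_stepMean_le (hμ : 0 < μ) (hγ : 0 < γ) {f : ℝ≥0 → ℝ} (hf : Measurable f)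
    {M : ℝ} (hM : ∀ a, |f a| ≤ M) (τ : ℝ≥0) : |stepMean μ γ f τ| ≤ rho μ γ * M := by
  have h0 : ∀ a : ℝ≥0, |(fun _ : ℝ≥0 => (0 : ℝ)) a| ≤ 0 := fun a => by simp
  have h1 := stepMean_le_add hμ hγ hf measurable_const hM h0 (τ := τ) (τ' := τ) (D := M)
    fun s => by simpa using (abs_le.1 (hM _)).2
  have h2 := stepMean_le_add hμ hγ measurable_const hf h0 hM (τ := τ) (τ' := τ) (D := M)
    fun s => by linarith [(abs_le.1 (hM (τ + s))).1]
  rw [stepMean_zero] at h1 h2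
  exact abs_le.2 ⟨by linarith, by linarith⟩

theorem exists_isBellman (hμ : 0 < μ) (hγ : 0 < γ) (hk : IsVal k) (hq : IsWin q) :
    ∃ V, IsBellman μ γ k q V := by
  obtain ⟨K, hK⟩ := hk.exists_abs_le
  have hnorm : ∀ (V : BoundedContinuousFunction ℝ≥0 ℝ) a, |V a| ≤ ‖V‖ := fun V a =>
    V.norm_coe_le_norm a
  have hc : ∀ V : BoundedContinuousFunction ℝ≥0 ℝ, Continuous (optContinuation k q V) := fun V =>
    continuous_optContinuation hk hq V.continuous
  have hb : ∀ V : BoundedContinuousFunction ℝ≥0 ℝ, ∀ a, |optContinuation k q V a|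
      ≤ ‖V‖ + (K + ‖V‖ + ‖V‖ + hq.bound) := fun V =>
    abs_optContinuation_le hq hK (hnorm V)
  -- The Bellman operator, to which Banach's fixed point theorem is applied.
  let T : BoundedContinuousFunction ℝ≥0 ℝ → BoundedContinuousFunction ℝ≥0 ℝ := fun V =>
    BoundedContinuousFunction.ofNormedAddCommGroup (stepMean μ γ (optContinuation k q V))
      (continuous_stepMean hμ hγ (hc V) (hb V)) _
      (abs_stepMean_le hμ hγ (hc V).measurable (hb V))
  have hle : ∀ (V W : BoundedContinuousFunction ℝ≥0 ℝ) τ,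
      T V τ ≤ T W τ + rho μ γ * dist V W := fun V W τ => by
    refine stepMean_le_add hμ hγ (hc V).measurable (hc W).measurable (hb V) (hb W) fun s => ?_
    have hd : ∀ a, V a ≤ W a + dist V W := fun a => by
      have := (abs_le.1 (BoundedContinuousFunction.dist_coe_le_dist (f := V) (g := W) a)).2
      linarith
    exact add_meanSurplus_self_le hq (hd _) (by linarith [hd 0])
  have hT : ContractingWith ⟨rho μ γ, rho_nonneg μ γ⟩ T := by
    refine ⟨by exact_mod_cast rho_lt_one hμ hγ, LipschitzWith.of_dist_le_mul fun V W => ?_⟩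
    refine (BoundedContinuousFunction.dist_le
      (mul_nonneg (rho_nonneg _ _) dist_nonneg)).2 fun τ => ?_
    have h1 := hle V W τ
    have h2 := hle W V τ
    rw [dist_comm W V] at h2
    rw [Real.dist_eq, abs_sub_le_iff]
    exact ⟨sub_le_iff_le_add'.2 h1, sub_le_iff_le_add'.2 h2⟩
  have h : T hT.fixedPoint = hT.fixedPoint := hT.fixedPoint_isFixedPt
  refine ⟨hT.fixedPoint, BoundedContinuousFunction.continuous _, ⟨_, hnorm _⟩, fun τ => ?_⟩
  exact (DFunLike.congr_fun h τ).symm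

/-! ### Optimality, monotone bids and stability of the Bellman solution -/

namespace IsBellman

variable {V : ℝ≥0 → ℝ}

theorem exists_abs_optContinuation_le (hk : IsVal k) (hq : IsWin q) (hV : IsBellman μ γ k q V) :
    ∃ M, ∀ a, |optContinuation k q V a| ≤ M := by
  obtain ⟨K, hK⟩ := hk.exists_abs_le
  obtain ⟨M, hM⟩ := hV.bdd
  exact ⟨_, abs_optContinuation_le hq hK hM⟩

/-- Truthful bidding dominates in each auction, so the excess of the policy value over `V` contracts
with no error term. -/
theorem policyValue_le (hμ : 0 < μ) (hγ : 0 < γ) (hk : IsVal k) (hq : IsWin q)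
    (hV : IsBellman μ γ k q V) {π : ℝ≥0 → ℝ≥0} (hπ : Measurable π) (τ : ℝ≥0) :
    policyValue μ γ k q π τ ≤ V τ := by
  obtain ⟨K, hK⟩ := hk.exists_abs_le
  obtain ⟨M, hM⟩ := hV.bdd
  have hW := abs_policyValue_le hμ hγ hk.cont.measurable hq hK hπ
  have hWm := measurable_policyValue hμ hγ hk.cont.measurable hq hK hπ
  have hWeq := policyValue_eq_stepMean hμ hγ hk.cont.measurable hq hK hπ
  set W := policyValue μ γ k q π
  have h := le_of_contractive hμ hγ (D := fun τ => W τ - V τ) (δ := 0)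
    ⟨_, fun τ => (le_abs_self _).trans ((abs_sub _ _).trans (add_le_add (hW τ) (hM τ)))⟩ le_rfl
    (fun M' hM' hD τ => by
      have h1 := stepMean_le_add hμ hγ (measurable_continuation hk hπ hWm)
        (continuous_optContinuation hk hq hV.cont).measurable (abs_continuation_le hq π hK hW)
        (abs_optContinuation_le hq hK hM) (τ := τ) (τ' := τ) (D := M') (fun s =>
          (continuation_le_optContinuation hq π W _).trans (add_meanSurplus_self_le hq
            (by linarith [hD (τ + s)]) (by linarith [hD 0])))
      rw [← hWeq, ← hV.eq] at h1
      linarith) τ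
  simp only [zero_div] at h
  linarith

/-- A loss of at most `δ` per auction accumulates to a geometric series. -/
theorem le_policyValue_add (hμ : 0 < μ) (hγ : 0 < γ) (hk : IsVal k) (hq : IsWin q)
    (hV : IsBellman μ γ k q V) {π : ℝ≥0 → ℝ≥0} (hπ : Measurable π) {δ : ℝ} (hδ : 0 ≤ δ)
    (h : ∀ a, optContinuation k q V a ≤ continuation k q π V a + δ) (τ : ℝ≥0) :
    V τ ≤ policyValue μ γ k q π τ + δ / (1 - rho μ γ) := by
  obtain ⟨K, hK⟩ := hk.exists_abs_le
  obtain ⟨M, hM⟩ := hV.bdd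
  have hW := abs_policyValue_le hμ hγ hk.cont.measurable hq hK hπ
  have hWm := measurable_policyValue hμ hγ hk.cont.measurable hq hK hπ
  have hWeq := policyValue_eq_stepMean hμ hγ hk.cont.measurable hq hK hπ
  set W := policyValue μ γ k q π
  have h := le_of_contractive hμ hγ (D := fun τ => V τ - W τ)
    ⟨_, fun τ => (le_abs_self _).trans ((abs_sub _ _).trans (add_le_add (hM τ) (hW τ)))⟩ hδ
    (fun M' hM' hD τ => by
      have h1 := stepMean_le_add hμ hγ (continuous_optContinuation hk hq hV.cont).measurable
        (measurable_continuation hk hπ hWm) (abs_optContinuation_le hq hK hM)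
        (abs_continuation_le hq π hK hW) (τ := τ) (τ' := τ) (D := M' + δ) (fun s => by
          refine (h _).trans ?_
          rw [← add_assoc]
          exact add_le_add_left (add_meanSurplus_le hq _
            (by linarith [hD (τ + s)]) (by linarith [hD 0])) _)
      rw [← hWeq, ← hV.eq] at h1
      have := mul_le_of_le_one_left hδ (rho_lt_one hμ hγ).le
      linarith) τ
  linarith

theorem nonneg (hμ : 0 < μ) (hγ : 0 < γ) (hk : IsVal k) (hq : IsWin q)
    (hV : IsBellman μ γ k q V) (τ : ℝ≥0) : 0 ≤ V τ := by
  obtain ⟨M, hM⟩ := hV.bdd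
  obtain ⟨M', hM'⟩ := hV.exists_abs_optContinuation_le hk hq
  have h := le_of_contractive hμ hγ (D := fun τ => - V τ) (δ := 0)
    ⟨M, fun τ => (neg_le_abs _).trans (hM τ)⟩ le_rfl
    (fun M₁ hM₁ hD τ => by
      have h1 := stepMean_le_add hμ hγ measurable_const
        (continuous_optContinuation hk hq hV.cont).measurable
        (f := fun _ => 0) (M := 0) (by simp) hM' (τ := τ) (τ' := τ) (D := M₁) (fun s => by
          have := meanSurplus_self_nonneg hq (k ↑(τ + s) + V 0 - V (τ + s))
          have := hD (τ + s)
          simp only [optContinuation]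
          linarith)
      rw [stepMean_zero, ← hV.eq] at h1
      linarith) τ
  simp only [zero_div] at h
  linarith

theorem le_div (hμ : 0 < μ) (hγ : 0 < γ) (hk : IsVal k) (hq : IsWin q)
    (hV : IsBellman μ γ k q V) {K : ℝ} (hK : ∀ a : ℝ≥0, k a ≤ K) (τ : ℝ≥0) :
    V τ ≤ K / (1 - rho μ γ) := by
  obtain ⟨M, hM⟩ := hV.bdd
  obtain ⟨M', hM'⟩ := hV.exists_abs_optContinuation_le hk hq
  have hK0 : 0 ≤ K := (hk.nonneg 0).trans (hK 0)
  refine le_of_contractive hμ hγ ⟨M, fun τ => (le_abs_self _).trans (hM τ)⟩ hK0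
    (fun M₁ hM₁ hD τ => ?_) τ
  have h1 := stepMean_le_add hμ hγ (continuous_optContinuation hk hq hV.cont).measurable
    measurable_const hM' (g := fun _ => 0) (M' := 0) (by simp) (τ := τ) (τ' := τ) (D := M₁ + K)
    (fun s => by
      -- The comparison point is an object worth `0`, whose truthful surplus vanishes.
      have h2 := add_meanSurplus_self_le hq (v := V (τ + s)) (v' := 0)
        (w := k ↑(τ + s) + V 0) (w' := 0) (E := M₁ + K) (by linarith [hD (τ + s)])
        (by linarith [hD 0, hK (τ + s)])
      rwa [sub_zero, meanSurplus_self_nonpos hq le_rfl, add_zero] at h2)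
  rw [stepMean_zero, ← hV.eq] at h1
  have := mul_le_of_le_one_left hK0 (rho_lt_one hμ hγ).le
  linarith

/-- The Bellman value grows more slowly than the value function. -/
theorem sub_le_sub (hμ : 0 < μ) (hγ : 0 < γ) (hk : IsVal k) (hq : IsWin q)
    (hV : IsBellman μ γ k q V) (h τ : ℝ≥0) : V (τ + h) - V τ ≤ k ↑(τ + h) - k τ := by
  obtain ⟨K, hK⟩ := hk.exists_abs_le
  obtain ⟨M, hM⟩ := hV.bdd
  obtain ⟨M', hM'⟩ := hV.exists_abs_optContinuation_le hk hq
  have hc := (continuous_optContinuation hk hq hV.cont).measurable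
  have hmono : ∀ a : ℝ≥0, k a ≤ k ↑(a + h) := fun a => hk.mono (by push_cast; linarith [h.2])
  have h := le_of_contractive hμ hγ (D := fun τ => V (τ + h) - V τ - (k ↑(τ + h) - k τ)) (δ := 0)
    ⟨M + M, fun τ => by
      linarith [hmono τ, (abs_le.1 (hM (τ + h))).2, (abs_le.1 (hM τ)).1]⟩ le_rfl
    (fun M₁ hM₁ hD τ => by
      have h1 := stepMean_le_add hμ hγ hc hc hM' hM' (τ := τ + h) (τ' := τ)
        (D := k ↑(τ + h) - k τ + M₁) (fun s => by
          -- Concavity: waiting `s` longer can only shrink the increment of `k`.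
          have h2 : k ↑(τ + h + s) - k ↑(τ + s) ≤ k ↑(τ + h) - k τ := by
            have h3 := hk.concave τ (τ + s) h τ.2 (by linarith [s.2]) h.2
            rw [add_right_comm]; push_cast; exact h3
          have h4 := hD (τ + s)
          rw [add_right_comm τ s h] at h4
          exact add_meanSurplus_self_le hq (by linarith) (by linarith))
      rw [← hV.eq, ← hV.eq] at h1
      have := mul_le_of_le_one_left (sub_nonneg.2 (hmono τ)) (rho_lt_one hμ hγ).le
      linarith) τ
  simp only [zero_div] at h
  linarith

theorem monotone_bid (hμ : 0 < μ) (hγ : 0 < γ) (hk : IsVal k) (hq : IsWin q)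
    (hV : IsBellman μ γ k q V) : Monotone fun τ : ℝ≥0 => k τ + V 0 - V τ := by
  intro τ τ' h
  have h1 := hV.sub_le_sub hμ hγ hk hq (τ' - τ) τ
  rw [add_tsub_cancel_of_le h] at h1
  simp only
  linarith

/-- At age `0` the bid is `k 0 ≥ 0`, and bids increase with age; the truncation in `solver` is thus
inactive. -/
theorem bid_nonneg (hμ : 0 < μ) (hγ : 0 < γ) (hk : IsVal k) (hq : IsWin q)
    (hV : IsBellman μ γ k q V) (τ : ℝ≥0) : 0 ≤ k τ + V 0 - V τ := by
  have h := hV.monotone_bid hμ hγ hk hq (zero_le (a := τ))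
  have h0 := hk.nonneg 0
  simp only [] at h
  linarith

theorem policyValue_bid (hμ : 0 < μ) (hγ : 0 < γ) (hk : IsVal k) (hq : IsWin q)
    (hV : IsBellman μ γ k q V) (τ : ℝ≥0) :
    policyValue μ γ k q (fun τ => (k τ + V 0 - V τ).toNNReal) τ = V τ := by
  have hk' := hk.cont
  have hV' := hV.cont
  have hπ : Measurable fun τ : ℝ≥0 => (k τ + V 0 - V τ).toNNReal :=
    Continuous.measurable (by fun_prop)
  refine le_antisymm (hV.policyValue_le hμ hγ hk hq hπ τ) ?_
  have h := hV.le_policyValue_add hμ hγ hk hq hπ le_rfl (fun a => by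
    rw [continuation, optContinuation, Real.coe_toNNReal', meanSurplus_max_zero hq, add_zero]) τ
  simpa using h

theorem bellmanValue_eq (hμ : 0 < μ) (hγ : 0 < γ) (hk : IsVal k) (hq : IsWin q)
    (hV : IsBellman μ γ k q V) : bellmanValue μ γ k q = V := by
  have hk' := hk.cont
  have hV' := hV.cont
  have hπ : Measurable fun τ : ℝ≥0 => (k τ + V 0 - V τ).toNNReal :=
    Continuous.measurable (by fun_prop)
  funext τ
  have hle : ∀ π : {π : ℝ≥0 → ℝ≥0 // Measurable π}, policyValue μ γ k q π.1 τ ≤ V τ := fun π =>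
    hV.policyValue_le hμ hγ hk hq π.2 τ
  have : Nonempty {π : ℝ≥0 → ℝ≥0 // Measurable π} := ⟨⟨_, hπ⟩⟩
  refine le_antisymm (ciSup_le hle) ?_
  rw [← hV.policyValue_bid hμ hγ hk hq τ]
  exact le_ciSup (f := fun π : {π : ℝ≥0 → ℝ≥0 // Measurable π} => policyValue μ γ k q π.1 τ)
    ⟨V τ, by rintro _ ⟨π, rfl⟩; exact hle π⟩ ⟨_, hπ⟩

theorem solver_eq (hμ : 0 < μ) (hγ : 0 < γ) (hk : IsVal k) (hq : IsWin q)
    (hV : IsBellman μ γ k q V) :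
    solver μ γ k q = fun τ : ℝ≥0 => (k τ + V 0 - V τ).toNNReal := by
  funext τ
  rw [solver, hV.bellmanValue_eq hμ hγ hk hq]

theorem measurable_solver (hμ : 0 < μ) (hγ : 0 < γ) (hk : IsVal k) (hq : IsWin q)
    (hV : IsBellman μ γ k q V) : Measurable (solver μ γ k q) := by
  have hk' := hk.cont
  have hV' := hV.cont
  rw [hV.solver_eq hμ hγ hk hq]
  exact Continuous.measurable (by fun_prop)

theorem coe_solver (hμ : 0 < μ) (hγ : 0 < γ) (hk : IsVal k) (hq : IsWin q)
    (hV : IsBellman μ γ k q V) (τ : ℝ≥0) : (solver μ γ k q τ : ℝ) = k τ + V 0 - V τ := by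
  rw [hV.solver_eq hμ hγ hk hq, Real.coe_toNNReal _ (hV.bid_nonneg hμ hγ hk hq τ)]

theorem isOptimal_solver (hμ : 0 < μ) (hγ : 0 < γ) (hk : IsVal k) (hq : IsWin q)
    (hV : IsBellman μ γ k q V) : IsOptimal μ γ k q (solver μ γ k q) := by
  refine ⟨hV.measurable_solver hμ hγ hk hq, fun π' hπ' τ => ?_⟩
  rw [hV.solver_eq hμ hγ hk hq, hV.policyValue_bid hμ hγ hk hq]
  exact hV.policyValue_le hμ hγ hk hq hπ' τ

/-- The Bellman value is Lipschitz in the environment. -/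
theorem abs_sub_le {k' q' : ℝ → ℝ} {V' : ℝ≥0 → ℝ} (hμ : 0 < μ) (hγ : 0 < γ)
    (hk : IsVal k) (hq : IsWin q) (hV : IsBellman μ γ k q V)
    (hk' : IsVal k') (hq' : IsWin q') (hV' : IsBellman μ γ k' q' V') {ε β : ℝ} (hε : 0 ≤ ε)
    (hβ : ∀ τ : ℝ≥0, k τ + V 0 - V τ ≤ β) (hkk' : ∀ τ : ℝ≥0, |k τ - k' τ| ≤ ε)
    (hqq' : ∀ v ∈ Set.Icc 0 β, |q v - q' v| ≤ ε) (τ : ℝ≥0) :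
    |V τ - V' τ| ≤ (ε + ε * β) / (1 - rho μ γ) := by
  obtain ⟨M, hM⟩ := hV.bdd
  obtain ⟨M', hM'⟩ := hV'.bdd
  obtain ⟨N, hN⟩ := hV.exists_abs_optContinuation_le hk hq
  obtain ⟨N', hN'⟩ := hV'.exists_abs_optContinuation_le hk' hq'
  have hc := (continuous_optContinuation hk hq hV.cont).measurable
  have hc' := (continuous_optContinuation hk' hq' hV'.cont).measurable
  have h0 := hV.bid_nonneg hμ hγ hk hq
  have hβ0 : 0 ≤ β := (h0 0).trans (hβ 0)
  have hδ : 0 ≤ ε + ε * β := by positivity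
  -- Both directions below change `q` into `q'` at the bids of `(k, q)`, which stay in `[0, β]`, and
  -- then move the bid with `q'` fixed, where the slope bound needs no closeness.
  have hG : ∀ a : ℝ≥0, |meanSurplus q (k a + V 0 - V a) (k a + V 0 - V a)
      - meanSurplus q' (k a + V 0 - V a) (k a + V 0 - V a)| ≤ ε * β := fun a =>
    abs_meanSurplus_sub_le hq hq' hε (h0 a) (hβ a) hqq'
  have hρ := mul_le_of_le_one_left hδ (rho_lt_one hμ hγ).le
  rw [abs_le']
  constructor
  · refine le_of_contractive hμ hγ (D := fun τ => V τ - V' τ)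
      ⟨_, fun τ => (le_abs_self _).trans ((abs_sub _ _).trans (add_le_add (hM τ) (hM' τ)))⟩ hδ
      (fun M₁ hM₁ hD τ => ?_) τ
    have h1 := stepMean_le_add hμ hγ hc hc' hN hN' (τ := τ) (τ' := τ) (D := M₁ + (ε + ε * β))
      (fun s => by
        have h2 := (abs_le.1 (hG (τ + s))).2
        have h3 := add_meanSurplus_self_le hq' (v := V (τ + s)) (v' := V' (τ + s))
          (w := k ↑(τ + s) + V 0) (w' := k' ↑(τ + s) + V' 0) (E := M₁ + ε)
          (by linarith [hD (τ + s)])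
          (by linarith [hD 0, (abs_le.1 (hkk' (τ + s))).2])
        simp only [optContinuation]
        linarith)
    rw [← hV.eq, ← hV'.eq] at h1
    linarith
  · rw [neg_sub]
    refine le_of_contractive hμ hγ (D := fun τ => V' τ - V τ)
      ⟨_, fun τ => (le_abs_self _).trans ((abs_sub _ _).trans (add_le_add (hM' τ) (hM τ)))⟩ hδ
      (fun M₁ hM₁ hD τ => ?_) τ
    have h1 := stepMean_le_add hμ hγ hc' hc hN' hN (τ := τ) (τ' := τ) (D := M₁ + (ε + ε * β))
      (fun s => by
        have h2 := (abs_le.1 (hG (τ + s))).1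
        have h3 := add_meanSurplus_self_le hq' (v := V' (τ + s)) (v' := V (τ + s))
          (w := k' ↑(τ + s) + V' 0) (w' := k ↑(τ + s) + V 0) (E := M₁ + ε)
          (by linarith [hD (τ + s)])
          (by linarith [hD 0, (abs_le.1 (hkk' (τ + s))).1])
        simp only [optContinuation]
        linarith)
    rw [← hV.eq, ← hV'.eq] at h1
    linarith

/-- A policy close to the optimal one loses at most the square of the deviation. -/
theorem abs_sub_policyValue_le {c : ℝ≥0} (hμ : 0 < μ) (hγ : 0 < γ) (hk : IsVal k) (hq : IsWin q)
    (hV : IsBellman μ γ k q V) (hc : LipschitzWith c q) {π : ℝ≥0 → ℝ≥0} (hπ : Measurable π)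
    {δ : ℝ} (h : ∀ a, |(solver μ γ k q a : ℝ) - π a| ≤ δ) (τ : ℝ≥0) :
    |V τ - policyValue μ γ k q π τ| ≤ c * δ ^ 2 / (1 - rho μ γ) := by
  rw [abs_of_nonneg (sub_nonneg.2 (hV.policyValue_le hμ hγ hk hq hπ τ)), sub_le_iff_le_add']
  refine hV.le_policyValue_add hμ hγ hk hq hπ (by positivity) (fun a => ?_) τ
  have h1 := h a
  rw [hV.coe_solver hμ hγ hk hq] at h1
  rw [optContinuation, continuation]
  set p := k a + V 0 - V a
  have h2 := meanSurplus_self_sub_le hq p (π a)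
  have h3 : (p - π a) * (q p - q (π a)) ≤ c * δ ^ 2 := by
    have h4 := hc.dist_le_mul p (π a)
    rw [Real.dist_eq, Real.dist_eq] at h4
    calc (p - π a) * (q p - q (π a)) ≤ |p - π a| * |q p - q (π a)| := by
          rw [← abs_mul]; exact le_abs_self _
      _ ≤ |p - π a| * (c * |p - π a|) := mul_le_mul_of_nonneg_left h4 (abs_nonneg _)
      _ = c * |p - π a| ^ 2 := by ring
      _ ≤ c * δ ^ 2 := by gcongr
  linarith

end IsBellman

end

/-! ### Piecewise linear environments -/

theorem min_sub_min_mono {r r' x y : ℝ} (hr : r ≤ r') (h : x ≤ y) :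
    min r' x - min r x ≤ min r' y - min r y := by
  simp only [min_def]; split_ifs <;> linarith

theorem min_sub_min_nonneg {r r' : ℝ} (hr : r ≤ r') (x : ℝ) : 0 ≤ min r' x - min r x :=
  sub_nonneg.2 (min_le_min_right x hr)

section

variable {n : ℕ} {s : Fin (n + 1) → ℝ} {c : Fin n → ℝ}

theorem IsGrid.nonneg (hs : IsGrid s) (i : Fin (n + 1)) : 0 ≤ s i :=
  hs.1 ▸ hs.2.monotone (Fin.zero_le i)

theorem piecewiseLinear_mono (hs : Monotone s) (hc : ∀ i, 0 ≤ c i) :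
    Monotone (piecewiseLinear s c) := fun _ _ h =>
  Finset.sum_le_sum fun i _ =>
    mul_le_mul_of_nonneg_left (min_sub_min_mono (hs i.castSucc_lt_succ.le) h) (hc i)

theorem continuous_piecewiseLinear : Continuous (piecewiseLinear s c) := by
  unfold piecewiseLinear; fun_prop

theorem piecewiseLinear_nonneg (hs : Monotone s) (hc : ∀ i, 0 ≤ c i) (x : ℝ) :
    0 ≤ piecewiseLinear s c x :=
  Finset.sum_nonneg fun i _ =>
    mul_nonneg (hc i) (min_sub_min_nonneg (hs i.castSucc_lt_succ.le) x)

theorem piecewiseLinear_of_nonpos (hs : IsGrid s) {x : ℝ} (hx : x ≤ 0) :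
    piecewiseLinear s c x = 0 :=
  Finset.sum_eq_zero fun i _ => by
    rw [min_eq_right (hx.trans (hs.nonneg _)), min_eq_right (hx.trans (hs.nonneg _)), sub_self,
      mul_zero]

theorem piecewiseLinear_of_last_le (hs : Monotone s) {x : ℝ} (hx : s (Fin.last n) ≤ x) :
    piecewiseLinear s c x = piecewiseLinear s c (s (Fin.last n)) := by
  have h : ∀ i, s i ≤ s (Fin.last n) := fun i => hs (Fin.le_last i)
  simp only [piecewiseLinear, min_eq_left (h _), min_eq_left ((h _).trans hx)]

theorem sum_min_sub_min (s : Fin (n + 1) → ℝ) (x : ℝ) :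
    ∑ i : Fin n, (min (s i.succ) x - min (s i.castSucc) x)
      = min (s (Fin.last n)) x - min (s 0) x := by
  induction n with
  | zero => simp
  | succ n ih =>
    rw [Fin.sum_univ_castSucc]
    have h := ih fun i => s i.castSucc
    simp only [Fin.castSucc_zero, ← Fin.succ_castSucc] at h ⊢
    rw [h, Fin.succ_last]
    ring

/-- Subtracting the last slope from all slopes leaves a function on the shorter grid plus one ramp.
For antitone `c` the remaining slopes stay nonnegative and antitone, so concavity follows by
induction. -/
theorem piecewiseLinear_succ {n : ℕ} (s : Fin (n + 2) → ℝ) (c : Fin (n + 1) → ℝ) (x : ℝ) :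
    piecewiseLinear s c x = piecewiseLinear (fun i => s i.castSucc)
        (fun i => c i.castSucc - c (Fin.last n)) x
      + c (Fin.last n) * (min (s (Fin.last (n + 1))) x - min (s 0) x) := by
  rw [← sum_min_sub_min, Finset.mul_sum]
  simp only [piecewiseLinear]
  rw [Fin.sum_univ_castSucc, Fin.sum_univ_castSucc (f := fun i => c (Fin.last n) * _),
    ← add_assoc, ← Finset.sum_add_distrib]
  congr 1
  refine Finset.sum_congr rfl fun i _ => ?_
  rw [Fin.succ_castSucc]
  ring

theorem piecewiseLinear_concave (hs : Monotone s) (hc : Antitone c) (hc0 : ∀ i, 0 ≤ c i)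
    {x y h : ℝ} (hx : s 0 ≤ x) (hxy : x ≤ y) (hh : 0 ≤ h) :
    piecewiseLinear s c (y + h) - piecewiseLinear s c y
      ≤ piecewiseLinear s c (x + h) - piecewiseLinear s c x := by
  induction n with
  | zero => simp [piecewiseLinear]
  | succ n ih =>
    have h1 := ih (s := fun i => s i.castSucc) (c := fun i => c i.castSucc - c (Fin.last n))
      (fun i j hij => hs hij) (fun i j hij => sub_le_sub_right (hc hij) _)
      (fun i => sub_nonneg.2 (hc (Fin.le_last _))) hx
    have h2 : c (Fin.last n) * (min (s (Fin.last (n + 1))) (y + h) - min (s (Fin.last (n + 1))) y)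
        ≤ c (Fin.last n) * (min (s (Fin.last (n + 1))) (x + h) - min (s (Fin.last (n + 1))) x) := by
      refine mul_le_mul_of_nonneg_left ?_ (hc0 _)
      simp only [min_def]; split_ifs <;> linarith
    simp only [piecewiseLinear_succ s c]
    rw [min_eq_left hx, min_eq_left (hx.trans hxy), min_eq_left (by linarith : s 0 ≤ x + h),
      min_eq_left (by linarith : s 0 ≤ y + h)]
    linarith

theorem isVal_of_mem {k : ℝ → ℝ} (hs : IsGrid s) (hk : k ∈ ValueClass s) : IsVal k := by
  obtain ⟨a, ha, ha0, rfl⟩ := hk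
  have hmono := piecewiseLinear_mono hs.2.monotone ha0
  refine ⟨hmono, continuous_piecewiseLinear, piecewiseLinear_nonneg hs.2.monotone ha0 0,
    ⟨piecewiseLinear s a (s (Fin.last n)), fun x => ?_⟩, fun x y h hx hxy hh =>
      piecewiseLinear_concave hs.2.monotone ha ha0 (hs.1 ▸ hx) hxy hh⟩
  rw [← piecewiseLinear_of_last_le hs.2.monotone (le_max_right x (s (Fin.last n)))]
  exact hmono (le_max_left _ _)

theorem isWin_of_mem {q : ℝ → ℝ} (hs : IsGrid s) (hq : q ∈ WinClass s) : IsWin q := by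
  obtain ⟨c, hc, rfl, h1⟩ := hq
  exact ⟨piecewiseLinear_mono hs.2.monotone fun i => (hc i).le, continuous_piecewiseLinear,
    fun v hv => piecewiseLinear_of_nonpos hs hv, h1,
    ⟨s (Fin.last n), hs.nonneg _, fun v hv => piecewiseLinear_of_last_le hs.2.monotone hv⟩⟩

end

end DynamicBidding

end

/-! ### Uniform constants and conclusion -/

theorem mainTheorem6 (μ γ : ℝ) (hμ : 0 < μ) (hγ : 0 < γ) (kmax : ℝ) (cmax : ℝ≥0) :
    ∃ C > (0 : ℝ), ∃ ε₀ > (0 : ℝ),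
      ∀ (m n : ℕ) (t : Fin (m + 1) → ℝ) (b : Fin (n + 1) → ℝ),
        DynamicBidding.IsGrid t → DynamicBidding.IsGrid b →
      ∀ ks ∈ DynamicBidding.ValueClass t, ∀ qs ∈ DynamicBidding.WinClass b,
        (∀ τ : ℝ≥0, ks τ ≤ kmax) → LipschitzWith cmax qs →
        DynamicBidding.IsOptimal μ γ ks qs (DynamicBidding.solver μ γ ks qs) ∧
        ∃ β : ℝ,
          Tendsto (fun τ : ℝ≥0 => (DynamicBidding.solver μ γ ks qs τ : ℝ)) atTop (𝓝 β) ∧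
          ∀ ε : ℝ, 0 < ε → ε ≤ ε₀ →
          ∀ k ∈ DynamicBidding.ValueClass t, ∀ q ∈ DynamicBidding.WinClass b,
            (∀ τ : ℝ≥0, |ks τ - k τ| ≤ ε) →
            (∀ v ∈ Set.Icc 0 β, |qs v - q v| ≤ ε) →
            (∀ τ : ℝ≥0, |(DynamicBidding.solver μ γ ks qs τ : ℝ)
                - (DynamicBidding.solver μ γ k q τ : ℝ)| ≤ C * ε) ∧
            (∀ τ : ℝ≥0, |DynamicBidding.bellmanValue μ γ ks qs τ
                - DynamicBidding.policyValue μ γ ks qs (DynamicBidding.solver μ γ k q) τ|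
                  ≤ C * ε ^ 2) := by
  set r := (1 - DynamicBidding.rho μ γ)⁻¹ with hr_def
  have hr : 0 < r := inv_pos.2 (sub_pos.2 (DynamicBidding.rho_lt_one hμ hγ))
  -- `B` bounds every bid `ks τ + V 0 - V τ`, since `0 ≤ V ≤ |kmax| * r`.
  set B := |kmax| + |kmax| * r
  have hB : 0 ≤ B := by positivity
  -- A bid contains `k` once and the value twice; each value is off by at most `(1 + B) * r * ε`.
  set C₁ := 1 + 2 * ((1 + B) * r)
  have hC₁ : 0 < C₁ := by positivity
  -- One auction loses at most `cmax * (C₁ * ε) ^ 2`, and `r` sums the discounted losses.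
  set C₂ := cmax * C₁ ^ 2 * r
  have hC₂ : 0 ≤ C₂ := by positivity
  refine ⟨C₁ + C₂, by positivity, 1, one_pos, ?_⟩
  intro m n t b ht hb ks hks qs hqs hkmax hlip
  have hks' := DynamicBidding.isVal_of_mem ht hks
  have hqs' := DynamicBidding.isWin_of_mem hb hqs
  obtain ⟨V, hV⟩ := DynamicBidding.exists_isBellman hμ hγ hks' hqs'
  refine ⟨hV.isOptimal_solver hμ hγ hks' hqs', ?_⟩
  have hbid : ∀ τ : ℝ≥0, ks τ + V 0 - V τ ≤ B := fun τ => by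
    have h1 := hV.nonneg hμ hγ hks' hqs' τ
    have h2 := hV.le_div hμ hγ hks' hqs' (fun a => (hkmax a).trans (le_abs_self _)) 0
    rw [div_eq_mul_inv, ← hr_def] at h2
    have h3 := (hkmax τ).trans (le_abs_self _)
    simp only [B]
    linarith
  have hbdd : BddAbove (Set.range fun τ : ℝ≥0 => ks τ + V 0 - V τ) :=
    ⟨B, by rintro _ ⟨τ, rfl⟩; exact hbid τ⟩
  -- Bids are monotone in the age, so their supremum is their limit.
  set β := ⨆ τ : ℝ≥0, (ks τ + V 0 - V τ)
  have hle : ∀ τ : ℝ≥0, ks τ + V 0 - V τ ≤ β := fun τ => le_ciSup hbdd τ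
  have hβB : β ≤ B := ciSup_le hbid
  refine ⟨β, ?_, ?_⟩
  · simp only [hV.coe_solver hμ hγ hks' hqs']
    exact tendsto_atTop_ciSup (hV.monotone_bid hμ hγ hks' hqs') hbdd
  intro ε hε _ k hk q hq hkε hqε
  have hk' := DynamicBidding.isVal_of_mem ht hk
  have hq' := DynamicBidding.isWin_of_mem hb hq
  obtain ⟨W, hW⟩ := DynamicBidding.exists_isBellman hμ hγ hk' hq'
  have hVW : ∀ τ, |V τ - W τ| ≤ (1 + B) * r * ε := fun τ => by
    refine (hV.abs_sub_le hμ hγ hks' hqs' hk' hq' hW hε.le hle hkε hqε τ).trans ?_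
    rw [div_eq_mul_inv, ← hr_def]
    have : ε + ε * β ≤ (1 + B) * ε := by nlinarith
    nlinarith
  have hsolver : ∀ τ : ℝ≥0, |(DynamicBidding.solver μ γ ks qs τ : ℝ) - (DynamicBidding.solver μ γ k q τ : ℝ)| ≤ C₁ * ε :=
    fun τ => by
      rw [hV.coe_solver hμ hγ hks' hqs', hW.coe_solver hμ hγ hk' hq']
      have h1 := abs_le.1 (hVW 0)
      have h2 := abs_le.1 (hVW τ)
      have h3 := abs_le.1 (hkε τ)
      simp only [C₁]
      exact abs_le.2 ⟨by linarith, by linarith⟩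
  refine ⟨fun τ => (hsolver τ).trans (by gcongr; linarith), fun τ => ?_⟩
  rw [hV.bellmanValue_eq hμ hγ hks' hqs']
  refine (hV.abs_sub_policyValue_le hμ hγ hks' hqs' hlip
    (hW.measurable_solver hμ hγ hk' hq') hsolver τ).trans ?_
  rw [div_eq_mul_inv, ← hr_def]
  have : (cmax : ℝ) * (C₁ * ε) ^ 2 * r = C₂ * ε ^ 2 := by simp only [C₂]; ring
  rw [this]
  gcongr
  linarith
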